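/- A *pointed graph* $\Gamma=(V\cup\{\bullet\},E)$ is a finite directed multigraph (multi-edges and loops allowed) with a distinguished vertex $\bullet$; the vertices in $V$ are called ordinary, and we write $V(\Gamma)=V\cup\{\bullet\}$. Its weight is $w(\Gamma)=|E|-|V|$. Isomorphisms are pairs of bijections of vertices and of edges compatible with sources and targets and preserving the distinguished vertex; $\mathrm{Aut}(\Gamma)$ is the group of automorphisms. $\Gamma$ is *stable* if $\deg^-(v)\ge 2$ and $\deg^+(v)\ge 2$ for every $v\in V$ (inward and outward degrees), and *semistable* if $\deg^-(v)\ge1$, $\deg^+(v)\ge1$ and $\deg^-(v)+\deg^+(v)\ge3$ for every $v\in V$. An edge $uv$ of a semistable pointed graph is *contractible* if $u\ne v$ and either $u\in V$ and $\deg^+(u)=1$, or $v\in V$ and $\deg^-(v)=1$. A semistable pointed graph $Z$ is *stabilizable* if successive contractions of finitely many contractible edges turn it into a stable pointed graph, called its *stabilization graph*. A *decorated tree* with external legs $A\,|\,B$ ($A$, $B$ finite sets) is a finite directed tree in which each $a\in A$ is attached to a vertex as an outward leg and each $b\in B$ as an inward leg; it is *pointed* if moreover one of its vertices is distinguished, the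 remaining vertices being ordinary (all vertices are ordinary if the tree is not pointed). The inward (outward) degree of a vertex counts the inward (outward) edges and legs at it, and semistability and contractible edges are defined as above in terms of ordinary vertices. A semistable decorated tree is called *contractible* if all its edges are contractible. Let $\mathscr T_g(A|B)$ (resp. $\mathscr T_f(A|B)$) be the set of contractible semistable decorated trees (resp. pointed decorated trees) with external legs $A\,|\,B$, up to isomorphisms preserving every leg (and the distinguished vertex). Give $T\in\mathscr T_g(A|B)$ the sign $(-1)^{|V(T)|+1}$, where $V(T)$ is the set of its vertices, and $T\in\mathscr T_f(A|B)$ the sign $(-1)^{|V|}$, where $V$ is the set of its ordinary vertices. For a stable pointed graph $\Gamma$, let $D(\Gamma)$ be the formal linear combination of isomorphism classes of pointed graphs obtained by expanding every vertex of $\Gamma$ while keeping the incidence relations: $D(\Gamma)$ is the sum, over all ways to choose for each ordinary vertex $v$ a tree in $\mathscr T_g(A_v|B_v)$ and for $\bullet$ a tree in $\mathscr T_f(A_\bullet|B_\bullet)$, where $A_v$ (resp. $B_v$) is the set of outward (resp. inward) half-edges of $\Gamma$ at $v$, of the product of the signs of the chosen trees times the pointed graph obtained from $\Gamma$ by replacing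 each vertex by the chosen tree and attaching each half-edge of $\Gamma$ at the vertex that carries the corresponding leg. **Theorem.** Let $\Gamma$ be a stable pointed graph of weight $k$. Then the sums below are finite and $$D(\Gamma)=\sum_{Z}\frac{(-1)^{|V(Z)|-|V(\Gamma)|}\,|\mathrm{Aut}(\Gamma)|}{|\mathrm{Aut}(Z)|}\,Z ,$$ where $Z$ runs over the isomorphism classes of stabilizable semistable pointed graphs of weight $k$ whose stabilization graph is $\Gamma$. That is, there are only finitely many ways of choosing the trees in the definition of $D(\Gamma)$, there are only finitely many such classes $Z$, and the equality holds in the $\mathbb Q$-vector space with basis the isomorphism classes of pointed graphs. -/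

import Mathlib

/-- A pointed graph: a finite directed multigraph (multi-edges and loops allowed) with a
distinguished vertex `pt`.  Here `V` is the set of *all* vertices, the distinguished one included;
the ordinary vertices are those different from `pt`. -/
structure PGraph : Type 1 where
  V : Type
  E : Type
  [finV : Finite V]
  [finE : Finite E]
  src : E → V
  tgt : E → V
  pt : V

namespace PGraph

attribute [instance] finV finE

/-- Outward degree of a vertex. -/
noncomputable def outDeg (G : PGraph) (v : G.V) : ℕ := Nat.card {e : G.E // G.src e = v}

/-- Inward degree of a vertex. -/
noncomputable def inDeg (G : PGraph) (v : G.V) : ℕ := Nat.card {e : G.E // G.tgt e = v}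

/-- Every ordinary vertex has inward and outward degree at least `2`. -/
def Stable (G : PGraph) : Prop :=
  ∀ v : G.V, v ≠ G.pt → 2 ≤ G.inDeg v ∧ 2 ≤ G.outDeg v

/-- Every ordinary vertex has inward and outward degree at least `1` and total degree at
least `3`. -/
def Semistable (G : PGraph) : Prop :=
  ∀ v : G.V, v ≠ G.pt → 1 ≤ G.inDeg v ∧ 1 ≤ G.outDeg v ∧ 3 ≤ G.inDeg v + G.outDeg v

/-- The weight: the number of edges minus the number of ordinary vertices. -/
noncomputable def weight (G : PGraph) : ℤ :=
  (Nat.card G.E : ℤ) - (Nat.card {v : G.V // v ≠ G.pt} : ℤ)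

/-- Isomorphisms of pointed graphs: bijections of vertices and of edges, compatible with sources
and targets, and preserving the distinguished vertex. -/
structure Iso (G H : PGraph) where
  v : G.V ≃ H.V
  e : G.E ≃ H.E
  src : ∀ x, H.src (e x) = v (G.src x)
  tgt : ∀ x, H.tgt (e x) = v (G.tgt x)
  pt : v G.pt = H.pt

/-- Isomorphism of pointed graphs as an equivalence relation. -/
instance isoSetoid : Setoid PGraph where
  r G H := Nonempty (Iso G H)
  iseqv :=
    { refl := fun G => ⟨⟨Equiv.refl _, Equiv.refl _, fun _ => rfl, fun _ => rfl, rfl⟩⟩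
      symm := by
        rintro G H ⟨f⟩
        refine ⟨⟨f.v.symm, f.e.symm, fun x => ?_, fun x => ?_, ?_⟩⟩
        · have h := f.src (f.e.symm x)
          rw [Equiv.apply_symm_apply] at h
          rw [h, Equiv.symm_apply_apply]
        · have h := f.tgt (f.e.symm x)
          rw [Equiv.apply_symm_apply] at h
          rw [h, Equiv.symm_apply_apply]
        · rw [← f.pt, Equiv.symm_apply_apply]
      trans := by
        rintro G H K ⟨f⟩ ⟨g⟩
        exact ⟨⟨f.v.trans g.v, f.e.trans g.e, fun x => by simp [g.src, f.src],
          fun x => by simp [g.tgt, f.tgt], by simp [f.pt, g.pt]⟩⟩ }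

/-- The order of the automorphism group of a pointed graph. -/
noncomputable def autCard (G : PGraph) : ℕ := Nat.card (Iso G G)

/-- An edge `e = uv` is contractible if `u ≠ v` and either `u` is an ordinary vertex of outward
degree `1`, or `v` is an ordinary vertex of inward degree `1`. -/
def Contractible (G : PGraph) (e : G.E) : Prop :=
  G.src e ≠ G.tgt e ∧
    ((G.src e ≠ G.pt ∧ G.outDeg (G.src e) = 1) ∨ (G.tgt e ≠ G.pt ∧ G.inDeg (G.tgt e) = 1))

/-- The graph obtained by contracting the edge `e`: its two endpoints are identified and `e` is
deleted. -/
def contract (G : PGraph) (e : G.E) : PGraph where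
  V := Quot (fun a b : G.V => a = G.src e ∧ b = G.tgt e)
  E := {x : G.E // x ≠ e}
  src x := Quot.mk _ (G.src x)
  tgt x := Quot.mk _ (G.tgt x)
  pt := Quot.mk _ G.pt

/-- `ContractsTo G H`: up to isomorphism, `H` is obtained from `G` by successively contracting
finitely many (possibly zero) edges, each contractible in the graph in which it is contracted. -/
inductive ContractsTo : PGraph → PGraph → Prop
  | of_iso {G H : PGraph} (h : G ≈ H) : ContractsTo G H
  | step {G H : PGraph} (e : G.E) (he : G.Contractible e)
      (h : ContractsTo (G.contract e) H) : ContractsTo G H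

/-- The semistable pointed graph `Z` is stabilizable, and `G` is its stabilization graph. -/
def HasStabilization (Z G : PGraph) : Prop :=
  Z.Semistable ∧ G.Stable ∧ ContractsTo Z G

end PGraph

/-- A directed tree decorated by finitely many outward legs labelled by `A` (the unbarred indices)
and inward legs labelled by `B` (the barred indices).  If the proposition `P` holds, the tree is
*pointed*, i.e. it carries a distinguished vertex; otherwise it has none.  Again `V` is the set of
all vertices.  A connected multigraph is a tree iff it has one vertex more than it has edges. -/
structure DecTree (P : Prop) (A B : Type) : Type 1 where
  V : Type
  E : Type
  [finV : Finite V]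
  [finE : Finite E]
  src : E → V
  tgt : E → V
  outLeg : A → V
  inLeg : B → V
  pt : P → V
  connected : ∀ x y : V, Relation.EqvGen (fun a b => ∃ e, src e = a ∧ tgt e = b) x y
  card_eq : Nat.card V = Nat.card E + 1

namespace DecTree

attribute [instance] finV finE

variable {P : Prop} {A B : Type}

/-- The vertices other than the distinguished one (all of them if the tree is not pointed). -/
def IsOrdinary (T : DecTree P A B) (v : T.V) : Prop := ∀ h : P, v ≠ T.pt h

/-- Number of outward half-edges at a vertex, legs included. -/
noncomputable def outDeg (T : DecTree P A B) (v : T.V) : ℕ :=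
  Nat.card {e : T.E // T.src e = v} + Nat.card {a : A // T.outLeg a = v}

/-- Number of inward half-edges at a vertex, legs included. -/
noncomputable def inDeg (T : DecTree P A B) (v : T.V) : ℕ :=
  Nat.card {e : T.E // T.tgt e = v} + Nat.card {b : B // T.inLeg b = v}

/-- Every ordinary vertex is semistable. -/
def Semistable (T : DecTree P A B) : Prop :=
  ∀ v : T.V, T.IsOrdinary v → 1 ≤ T.inDeg v ∧ 1 ≤ T.outDeg v ∧ 3 ≤ T.inDeg v + T.outDeg v

/-- All edges of the tree are contractible. -/
def Contractible (T : DecTree P A B) : Prop :=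
  ∀ e : T.E, T.src e ≠ T.tgt e ∧
    ((T.IsOrdinary (T.src e) ∧ T.outDeg (T.src e) = 1) ∨
      (T.IsOrdinary (T.tgt e) ∧ T.inDeg (T.tgt e) = 1))

/-- Isomorphisms of decorated trees: they preserve every leg label and the distinguished vertex
(if there is one). -/
structure Iso (S T : DecTree P A B) where
  v : S.V ≃ T.V
  e : S.E ≃ T.E
  src : ∀ x, T.src (e x) = v (S.src x)
  tgt : ∀ x, T.tgt (e x) = v (S.tgt x)
  outLeg : ∀ a, T.outLeg a = v (S.outLeg a)
  inLeg : ∀ b, T.inLeg b = v (S.inLeg b)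
  pt : ∀ h, T.pt h = v (S.pt h)

end DecTree

/-- Contractible semistable decorated trees with outward legs `A` and inward legs `B`. -/
def ContractibleTree (P : Prop) (A B : Type) : Type 1 :=
  {T : DecTree P A B // T.Semistable ∧ T.Contractible}

/-- Isomorphism of contractible semistable decorated trees as an equivalence relation. -/
instance ContractibleTree.isoSetoid (P : Prop) (A B : Type) :
    Setoid (ContractibleTree P A B) where
  r S T := Nonempty (DecTree.Iso S.1 T.1)
  iseqv :=
    { refl := fun G => ⟨⟨Equiv.refl _, Equiv.refl _, fun _ => rfl, fun _ => rfl, fun _ => rfl,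
        fun _ => rfl, fun _ => rfl⟩⟩
      symm := by
        rintro G H ⟨f⟩
        refine ⟨⟨f.v.symm, f.e.symm, fun x => ?_, fun x => ?_, fun a => ?_, fun b => ?_,
          fun h => ?_⟩⟩
        · have h := f.src (f.e.symm x)
          rw [Equiv.apply_symm_apply] at h
          rw [h, Equiv.symm_apply_apply]
        · have h := f.tgt (f.e.symm x)
          rw [Equiv.apply_symm_apply] at h
          rw [h, Equiv.symm_apply_apply]
        · rw [f.outLeg, Equiv.symm_apply_apply]
        · rw [f.inLeg, Equiv.symm_apply_apply]
        · rw [f.pt, Equiv.symm_apply_apply]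
      trans := by
        rintro G H K ⟨f⟩ ⟨g⟩
        exact ⟨⟨f.v.trans g.v, f.e.trans g.e, fun x => by simp [g.src, f.src],
          fun x => by simp [g.tgt, f.tgt], fun a => by simp [g.outLeg, f.outLeg],
          fun b => by simp [g.inLeg, f.inLeg], fun h => by simp [g.pt, f.pt]⟩⟩ }

/-- The set of contractible semistable trees with external legs `A | B`, where trees that are
isomorphic compatibly with the labels of the legs are identified.  With `P` false these are the
trees occurring in the expansion of the metric tensor derivative `g_{A B}`, with `P` true the
pointed trees occurring in the expansion of the derivative `f_{A B}` of a function. -/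
def TreeClass (P : Prop) (A B : Type) : Type 1 := Quotient (ContractibleTree.isoSetoid P A B)

/-- A tree representing the class. -/
noncomputable def TreeClass.tree {P : Prop} {A B : Type} (t : TreeClass P A B) : DecTree P A B :=
  (Quotient.out t).1

/-- The sign of a tree, `(-1)` to the total number of vertices plus one.  For a pointed tree with
set of ordinary vertices `V` this is `(-1) ^ |V|`. -/
noncomputable def TreeClass.sign {P : Prop} {A B : Type} (t : TreeClass P A B) : ℚ :=
  (-1) ^ (Nat.card t.tree.V + 1)

namespace PGraph

/-- A term in the expansion of `G`: for each vertex `v` a contractible semistable tree whose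
outward (inward) legs are the outward (inward) half-edges of `G` at `v`; this tree is pointed exactly
if `v` is the distinguished vertex. -/
def Expansion (G : PGraph) : Type 1 :=
  ∀ v : G.V, TreeClass (v = G.pt) {e : G.E // G.src e = v} {e : G.E // G.tgt e = v}

/-- Replace each vertex `v` of `G` by a tree `T v`, keeping the incidence relations: an edge `e`
of `G` now runs from the vertex carrying the outward leg `e` in the tree at the source of `e` to the
vertex carrying the inward leg `e` in the tree at the target of `e`. -/
def substitute (G : PGraph)
    (T : ∀ v : G.V, DecTree (v = G.pt) {e : G.E // G.src e = v} {e : G.E // G.tgt e = v}) :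
    PGraph where
  V := Σ v : G.V, (T v).V
  E := G.E ⊕ (Σ v : G.V, (T v).E)
  src := Sum.elim (fun e => ⟨G.src e, (T (G.src e)).outLeg ⟨e, rfl⟩⟩)
    (fun x => ⟨x.1, (T x.1).src x.2⟩)
  tgt := Sum.elim (fun e => ⟨G.tgt e, (T (G.tgt e)).inLeg ⟨e, rfl⟩⟩)
    (fun x => ⟨x.1, (T x.1).tgt x.2⟩)
  pt := ⟨G.pt, (T G.pt).pt rfl⟩

/-- Isomorphism classes of pointed graphs. -/
abbrev Class : Type 1 := Quotient PGraph.isoSetoid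

/-- The formal linear combination `D(G)` of (isomorphism classes of) pointed graphs, obtained by
expanding each vertex of `G` as the signed sum of contractible semistable trees, multilinearly and
keeping the incidence relations of `G`.  (The index set of the sum is finite for every stable `G`.) -/
noncomputable def D (G : PGraph) : Class →₀ ℚ :=
  ∑ᶠ x : G.Expansion,
    Finsupp.single (⟦G.substitute (fun v => (x v).tree)⟧ : Class) (∏ᶠ v : G.V, (x v).sign)

/-- Isomorphism classes of stabilizable semistable pointed graphs of weight `k` whose
stabilization graph is `G`. -/
def stabilizingClasses (k : ℤ) (G : PGraph) : Set Class :=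
  {z | ∃ Z : PGraph, z = ⟦Z⟧ ∧ Z.weight = k ∧ Z.HasStabilization G}

/-- The coefficient `(-1)^{|V(Z)| - |V(G)|} |Aut G| / |Aut Z|`. -/
noncomputable def coeff (G Z : PGraph) : ℚ :=
  (-1) ^ ((Nat.card Z.V : ℤ) - (Nat.card G.V : ℤ)) * (G.autCard : ℚ) / (Z.autCard : ℚ)

end PGraph

/-! Both sides are compared by counting collapses. A collapse `Z → Γ` (`PGraph.Collapse`) sends
vertices of `Z` onto those of `Γ`, its fibres being the components of the subgraph of contractible
edges, and identifies the edges of `Γ` with the non-contractible edges of `Z`.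

For `Z` semistable of the weight of the stable graph `Γ`, a collapse exists iff `Γ` is the
stabilization of `Z` (`Collapse.nonempty_iff`). The set of collapses is counted in two ways. Fibres
and surviving edges depend on `Z` alone, so `Aut Γ` acts simply transitively on it, and it has `|Aut
Γ|` elements (`Collapse.card_eq_autCard`). It is also in bijection with the pairs of a term `x` of
the expansion and an isomorphism `x.graph ≅ Z` (`Expansion.toCollapse_injective`,
`Expansion.toCollapse_surjective`): the fibres of a collapse are contractible trees, and these have
no nontrivial automorphisms (`Semistable.iso_self_eq`). So the number of terms isomorphic to `Z`,
times `|Aut Z|`, is `|Aut Γ|`. The sign of a term depends only on the number of vertices of its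
graph. -/

/-! ### Linear algebra of the coboundary map of a graph. -/

section Coboundary

variable {V E W : Type}

/-- A function constant along edges is constant on connected components. -/
theorem eq_of_eqvGen_edges {X : Type} {s t : E → V} {g : V → X} (hg : ∀ e, g (s e) = g (t e))
    {a b : V} (h : Relation.EqvGen (fun a b => ∃ e, s e = a ∧ t e = b) a b) : g a = g b := by
  induction h with
  | rel x y h => obtain ⟨e, rfl, rfl⟩ := h; exact hg e
  | refl => rfl
  | symm _ _ _ ih => exact ih.symm
  | trans _ _ _ _ _ ih₁ ih₂ => exact ih₁.trans ih₂

open Classical in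
/-- The coboundary of a function on vertices, together with its sums over the fibres of `φ`. -/
noncomputable def coboundarySum [Fintype V] (s t : E → V) (φ : V → W) :
    (V → ℚ) →ₗ[ℚ] (E → ℚ) × (W → ℚ) where
  toFun g := (fun e => g (t e) - g (s e), fun w => ∑ a, if φ a = w then g a else 0)
  map_add' g h := by
    ext x
    · simp; ring
    · simp [← Finset.sum_add_distrib, ← Finset.sum_filter]
  map_smul' c g := by
    ext x
    · simp; ring
    · simp [Finset.mul_sum]

/-- A function in the kernel is constant on each fibre of `φ`, as the edges connect the fibre. Its
sum over the fibre is then that constant times a nonzero cardinality. -/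
theorem coboundarySum_injective [Fintype V] (s t : E → V) (φ : V → W)
    (h : ∀ a b, φ a = φ b → Relation.EqvGen (fun a b => ∃ e, s e = a ∧ t e = b) a b) :
    Function.Injective (coboundarySum s t φ) := by
  classical
  rw [injective_iff_map_eq_zero]
  intro g hg
  have h1 : ∀ e, g (s e) = g (t e) := fun e => by
    have := congrFun (congrArg Prod.fst hg) e
    simp only [coboundarySum, LinearMap.coe_mk, AddHom.coe_mk, Prod.fst_zero, Pi.zero_apply] at this
    linarith
  funext b
  have h2 := congrFun (congrArg Prod.snd hg) (φ b)
  simp only [coboundarySum, LinearMap.coe_mk, AddHom.coe_mk, Prod.snd_zero, Pi.zero_apply] at h2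
  have h3 : ∀ a, (if φ a = φ b then g a else 0) = if φ a = φ b then g b else 0 := fun a => by
    split_ifs with hab
    · exact eq_of_eqvGen_edges h1 (h a b hab)
    · rfl
  simp only [h3] at h2
  rw [← Finset.sum_filter, Finset.sum_const, nsmul_eq_mul] at h2
  rcases mul_eq_zero.1 h2 with h4 | h4
  · rw [Nat.cast_eq_zero, Finset.card_eq_zero] at h4
    exact absurd (h4 ▸ Finset.mem_filter.2 ⟨Finset.mem_univ b, rfl⟩ : b ∈ (∅ : Finset V)) (by simp)
  · exact h4

/-- If the edges connect the fibres of `φ : V → W`, there are at least `|V| - |W|` edges. -/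
theorem card_le_card_add_card_of_connected [Finite V] [Finite E] [Finite W] (s t : E → V) (φ : V → W)
    (h : ∀ a b, φ a = φ b → Relation.EqvGen (fun a b => ∃ e, s e = a ∧ t e = b) a b) :
    Nat.card V ≤ Nat.card E + Nat.card W := by
  have := Fintype.ofFinite V
  have := Fintype.ofFinite E
  have := Fintype.ofFinite W
  have := LinearMap.finrank_le_finrank_of_injective (coboundarySum_injective s t φ h)
  simpa using this

theorem trace_funLeft_perm {X : Type} [Finite X] (f : Equiv.Perm X) :
    LinearMap.trace ℚ (X → ℚ) (LinearMap.funLeft ℚ ℚ f) = Nat.card {x // f x = x} := by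
  classical
  have := Fintype.ofFinite X
  rw [LinearMap.trace_eq_matrix_trace ℚ (Pi.basisFun ℚ X), Matrix.trace]
  simp only [Matrix.diag_apply, LinearMap.toMatrix_apply, Pi.basisFun_apply, Pi.basisFun_repr,
    LinearMap.funLeft_apply, Pi.single_apply]
  rw [Finset.sum_boole, Nat.card_eq_fintype_card, Fintype.card_subtype]

/-- The Lefschetz fixed point formula for a tree. -/
theorem card_fixed_of_tree [Finite V] [Finite E] (s t : E → V)
    (h : ∀ a b, Relation.EqvGen (fun a b => ∃ e, s e = a ∧ t e = b) a b)
    (hc : Nat.card V = Nat.card E + 1) (f : Equiv.Perm V) (k : Equiv.Perm E)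
    (hs : ∀ e, s (k e) = f (s e)) (ht : ∀ e, t (k e) = f (t e)) :
    Nat.card {x // f x = x} = Nat.card {x // k x = x} + 1 := by
  classical
  have := Fintype.ofFinite V
  have := Fintype.ofFinite E
  have hi := coboundarySum_injective s t (fun _ => ()) (fun a b _ => h a b)
  have hd : Module.finrank ℚ (V → ℚ) = Module.finrank ℚ ((E → ℚ) × (Unit → ℚ)) := by
    simpa using hc
  -- For a tree, coboundary plus total sum is an isomorphism by equality of dimensions. It
  -- intertwines the permutation of the vertices with that of the edges plus the identity on one
  -- extra line, so comparing traces compares fixed points.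
  let L := LinearEquiv.ofInjectiveOfFinrankEq _ hi hd
  have hL : ∀ g, L g = coboundarySum s t (fun _ => ()) g := fun g => rfl
  have key : L.conj (LinearMap.funLeft ℚ ℚ f) =
      (LinearMap.funLeft ℚ ℚ k).prodMap (LinearMap.id : (Unit → ℚ) →ₗ[ℚ] _) := by
    apply LinearMap.ext
    intro y
    obtain ⟨g, rfl⟩ := L.surjective y
    rw [LinearEquiv.conj_apply]
    simp only [LinearMap.comp_apply, LinearEquiv.coe_coe, LinearEquiv.symm_apply_apply]
    rw [hL, hL]
    ext x
    · simp [coboundarySum, LinearMap.funLeft_apply, hs, ht]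
    · simp only [coboundarySum, LinearMap.coe_mk, AddHom.coe_mk, LinearMap.funLeft_apply,
        if_true, LinearMap.prodMap_apply, LinearMap.id_apply]
      exact Equiv.sum_comp f g
  have h1 := LinearMap.trace_conj' (LinearMap.funLeft ℚ ℚ f) L
  rw [key, LinearMap.trace_prodMap', trace_funLeft_perm, trace_funLeft_perm, LinearMap.trace_id] at h1
  simp only [Module.finrank_fintype_fun_eq_card, Fintype.card_unit] at h1
  exact_mod_cast h1.symm

end Coboundary

/-! ### Rigidity and finiteness of semistable trees. -/

/-- Double counting along a map to a finite type. -/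
theorem sum_card_fibers {X Y : Type} [Finite X] [Fintype Y] (f : X → Y) :
    ∑ y, Nat.card {x // f x = y} = Nat.card X := by
  rw [← Nat.card_sigma]
  exact Nat.card_congr (Equiv.sigmaFiberEquiv f)

theorem sum_card_fibers_filter {X Y : Type} [Finite X] [Fintype Y] (f : X → Y) (p : Y → Prop)
    [DecidablePred p] :
    ∑ y with p y, Nat.card {x // f x = y} = Nat.card {x // p (f x)} := by
  classical
  have := Fintype.ofFinite X
  simp only [Nat.card_eq_fintype_card, Fintype.card_subtype]
  rw [Finset.card_eq_sum_card_fiberwise (f := f) (t := Finset.univ.filter p)]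
  · refine Finset.sum_congr rfl fun y hy => ?_
    congr 1
    ext x
    simp only [Finset.mem_filter, Finset.mem_univ, true_and] at hy ⊢
    exact ⟨fun h => ⟨h ▸ hy, h⟩, fun h => h.2⟩
  · intro x
    simp

namespace DecTree

variable {P : Prop} {A B : Type}

/-- A semistable decorated tree has no automorphisms. -/
theorem Semistable.iso_self_eq {T : DecTree P A B} (hT : T.Semistable) (f : Iso T T) :
    (∀ x, f.v x = x) ∧ ∀ x, f.e x = x := by
  classical
  have := Fintype.ofFinite T.V
  have := Fintype.ofFinite T.E
  have h1 := card_fixed_of_tree T.src T.tgt T.connected T.card_eq f.v f.e f.src f.tgt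
  have h2 := T.card_eq
  have hV : Nat.card {x // f.v x = x} + Nat.card {x // ¬ f.v x = x} = Nat.card T.V := by
    simp only [Nat.card_eq_fintype_card]
    exact Fintype.card_subtype_compl (fun x => f.v x = x) ▸
      Nat.add_sub_cancel' (Fintype.card_subtype_le _)
  have hE : Nat.card {x // f.e x = x} + Nat.card {x // ¬ f.e x = x} = Nat.card T.E := by
    simp only [Nat.card_eq_fintype_card]
    exact Fintype.card_subtype_compl (fun x => f.e x = x) ▸
      Nat.add_sub_cancel' (Fintype.card_subtype_le _)
  -- A moved vertex is ordinary and carries no legs, because these are preserved; its degree of at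
  -- least three comes from edges alone.
  have hdeg : ∀ v, ¬ f.v v = v →
      3 ≤ Nat.card {e // T.src e = v} + Nat.card {e // T.tgt e = v} := fun v hv => by
    have ho : T.IsOrdinary v := fun hp h => hv (by rw [h]; exact (f.pt hp).symm)
    have h3 := (hT v ho).2.2
    have ha : IsEmpty {a // T.outLeg a = v} := ⟨fun a => hv (by rw [← a.2]; exact (f.outLeg a).symm)⟩
    have hb : IsEmpty {a // T.inLeg a = v} := ⟨fun a => hv (by rw [← a.2]; exact (f.inLeg a).symm)⟩
    rw [inDeg, outDeg, Nat.card_of_isEmpty (α := {a // T.outLeg a = v}),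
      Nat.card_of_isEmpty (α := {a // T.inLeg a = v})] at h3
    omega
  have hsum := Finset.sum_le_sum (s := Finset.univ.filter fun v => ¬ f.v v = v)
    (fun v hv => hdeg v (Finset.mem_filter.1 hv).2)
  rw [Finset.sum_add_distrib, sum_card_fibers_filter T.src (fun v => ¬ f.v v = v),
    sum_card_fibers_filter T.tgt (fun v => ¬ f.v v = v), Finset.sum_const, smul_eq_mul,
    ← Fintype.card_subtype, ← Nat.card_eq_fintype_card] at hsum
  -- An edge with a moved end is itself moved.
  have hs : Nat.card {e // ¬ f.v (T.src e) = T.src e} ≤ Nat.card {e // ¬ f.e e = e} :=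
    Nat.card_le_card_of_injective
      (fun e => ⟨e.1, fun h => e.2 (by rw [← f.src, h])⟩)
      (fun a b h => Subtype.ext (by simpa [Subtype.ext_iff] using h))
  have ht : Nat.card {e // ¬ f.v (T.tgt e) = T.tgt e} ≤ Nat.card {e // ¬ f.e e = e} :=
    Nat.card_le_card_of_injective
      (fun e => ⟨e.1, fun h => e.2 (by rw [← f.tgt, h])⟩)
      (fun a b h => Subtype.ext (by simpa [Subtype.ext_iff] using h))
  -- By the fixed point formula and `T.card_eq`, equally many vertices and edges are moved, say `m`.
  -- Counting ends of edges at moved vertices gives `3 * m ≤ 2 * m`.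
  have h0 : Nat.card {e // ¬ f.e e = e} = 0 ∧ Nat.card {v // ¬ f.v v = v} = 0 := by omega
  constructor
  · intro x
    by_contra hx
    have := (Finite.card_eq_zero_iff (α := {v // ¬ f.v v = v})).1 h0.2
    exact this.elim ⟨x, hx⟩
  · intro x
    by_contra hx
    have := (Finite.card_eq_zero_iff (α := {v // ¬ f.e v = v})).1 h0.1
    exact this.elim ⟨x, hx⟩

/-- The degrees sum to `2 * |E| + |A| + |B|` with `|E| = |V| - 1`, and each ordinary vertex
contributes at least three. The bound `3 * (|V| - 1)` allows for a distinguished vertex, on which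
there is no condition. -/
theorem Semistable.card_le [Finite A] [Finite B] {T : DecTree P A B} (hT : T.Semistable) :
    Nat.card T.V ≤ Nat.card A + Nat.card B + 1 := by
  classical
  have := Fintype.ofFinite T.V
  have hsum := sum_card_fibers T.src
  have hsum' := sum_card_fibers T.tgt
  have hA := sum_card_fibers T.outLeg
  have hB := sum_card_fibers T.inLeg
  have h : 3 * (Nat.card T.V - 1) ≤ ∑ v, (T.inDeg v + T.outDeg v) := by
    by_cases hP : P
    · rw [Nat.card_eq_fintype_card, ← Finset.card_univ,
        ← Finset.card_erase_of_mem (Finset.mem_univ (T.pt hP)), mul_comm, ← smul_eq_mul,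
        ← Finset.sum_const]
      exact (Finset.sum_le_sum fun v hv => (hT v fun _ => Finset.ne_of_mem_erase hv).2.2).trans
        (Finset.sum_le_sum_of_subset (Finset.subset_univ _))
    · have := Finset.sum_le_sum (s := Finset.univ) fun v _ => (hT v fun h => absurd h hP).2.2
      rw [Finset.sum_const, smul_eq_mul, Finset.card_univ, ← Nat.card_eq_fintype_card] at this
      omega
  simp only [inDeg, outDeg, Finset.sum_add_distrib, hsum, hsum', hA, hB] at h
  have := T.card_eq
  omega

end DecTree

namespace TreeClass

variable {P : Prop} {A B : Type}

theorem eq_of_iso {t u : TreeClass P A B} (f : DecTree.Iso t.tree u.tree) : t = u := by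
  rw [← Quotient.out_eq t, ← Quotient.out_eq u]
  exact Quotient.sound ⟨f⟩

theorem semistable_tree (t : TreeClass P A B) : t.tree.Semistable := (Quotient.out t).2.1

theorem contractible_tree (t : TreeClass P A B) : t.tree.Contractible := (Quotient.out t).2.2

theorem exists_iso_tree {T : DecTree P A B} (h : T.Semistable) (h' : T.Contractible) :
    ∃ t : TreeClass P A B, Nonempty (DecTree.Iso t.tree T) :=
  ⟨Quotient.mk _ ⟨T, h, h'⟩, Quotient.exact (Quotient.out_eq (Quotient.mk
    (ContractibleTree.isoSetoid P A B) ⟨T, h, h'⟩))⟩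

end TreeClass

/-- There are finitely many semistable contractible trees with given finite sets of legs. -/
instance TreeClass.finite (P : Prop) (A B : Type) [Finite A] [Finite B] :
    Finite (TreeClass P A B) := by
  classical
  let N := Nat.card A + Nat.card B + 2
  -- A tree is encoded by its tables of incidences on initial segments of `ℕ`. `PLift P` makes the
  -- proposition `P` the domain of the table for the distinguished vertex.
  let K := Σ n : Fin N × Fin N, (Fin n.2 → Fin n.1) × (Fin n.2 → Fin n.1) × (A → Fin n.1) ×
    (B → Fin n.1) × (PLift P → Fin n.1)
  have hK : ∀ t : TreeClass P A B, ∃ k : K, ∃ (v : t.tree.V ≃ Fin k.1.1) (e : t.tree.E ≃ Fin k.1.2),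
      (∀ x, k.2.1 (e x) = v (t.tree.src x)) ∧ (∀ x, k.2.2.1 (e x) = v (t.tree.tgt x)) ∧
      (∀ x, k.2.2.2.1 x = v (t.tree.outLeg x)) ∧ (∀ x, k.2.2.2.2.1 x = v (t.tree.inLeg x)) ∧
      ∀ h, k.2.2.2.2.2 ⟨h⟩ = v (t.tree.pt h) := fun t => by
    have hV : Nat.card t.tree.V ≤ Nat.card A + Nat.card B + 1 :=
      t.semistable_tree.card_le
    have hE := t.tree.card_eq
    let v := Finite.equivFin t.tree.V
    let e := Finite.equivFin t.tree.E
    refine ⟨⟨⟨⟨Nat.card t.tree.V, by omega⟩, ⟨Nat.card t.tree.E, by omega⟩⟩,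
      fun x => v (t.tree.src (e.symm x)), fun x => v (t.tree.tgt (e.symm x)),
      fun x => v (t.tree.outLeg x), fun x => v (t.tree.inLeg x), fun h => v (t.tree.pt h.down)⟩,
      v, e, ?_, ?_, ?_, ?_, ?_⟩ <;> intro x <;> simp
  choose k v e h1 h2 h3 h4 h5 using hK
  refine Finite.of_injective k fun t u htu => ?_
  -- The equivalences of `u` have types depending on `k u`; quantifying over them lets the whole
  -- statement be rewritten along `htu`.
  have hv : ∃ (w : u.tree.V ≃ Fin (k t).1.1) (d : u.tree.E ≃ Fin (k t).1.2),
      (∀ x, (k t).2.1 (d x) = w (u.tree.src x)) ∧ (∀ x, (k t).2.2.1 (d x) = w (u.tree.tgt x)) ∧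
      (∀ x, (k t).2.2.2.1 x = w (u.tree.outLeg x)) ∧ (∀ x, (k t).2.2.2.2.1 x = w (u.tree.inLeg x)) ∧
      ∀ h, (k t).2.2.2.2.2 ⟨h⟩ = w (u.tree.pt h) := by
    rw [htu]
    exact ⟨v u, e u, h1 u, h2 u, h3 u, h4 u, h5 u⟩
  obtain ⟨w, d, g1, g2, g3, g4, g5⟩ := hv
  refine TreeClass.eq_of_iso ⟨(v t).trans w.symm, (e t).trans d.symm, fun x => ?_, fun x => ?_, fun x => ?_,
    fun x => ?_, fun x => ?_⟩ <;> apply w.injective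
  · exact ((g1 _).symm.trans (by simp)).trans ((h1 t x).trans (by simp))
  · exact ((g2 _).symm.trans (by simp)).trans ((h2 t x).trans (by simp))
  · exact ((g3 _).symm.trans (by simp)).trans ((h3 t x).trans (by simp))
  · exact ((g4 _).symm.trans (by simp)).trans ((h4 t x).trans (by simp))
  · exact ((g5 _).symm.trans (by simp)).trans ((h5 t x).trans (by simp))

theorem Nat.card_ne_add_one {X : Type} [Finite X] (x : X) :
    Nat.card {y // y ≠ x} + 1 = Nat.card X := by
  have := Set.ncard_add_ncard_compl {x}
  rw [Set.ncard_singleton, add_comm] at this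
  exact this

/-! ### Contraction of a single edge. -/

namespace PGraph

theorem weight_eq (G : PGraph) : G.weight = (Nat.card G.E : ℤ) - Nat.card G.V + 1 := by
  rw [weight, ← Nat.card_ne_add_one G.pt]
  push_cast
  ring

/-- The graph with all edges reversed. -/
def op (G : PGraph) : PGraph where
  V := G.V
  E := G.E
  src := G.tgt
  tgt := G.src
  pt := G.pt

theorem Semistable.op {G : PGraph} (h : G.Semistable) : G.op.Semistable := fun v hv =>
  ⟨(h v hv).2.1, (h v hv).1, by rw [add_comm]; exact (h v hv).2.2⟩

theorem contractible_op {G : PGraph} {e : G.E} : G.op.Contractible e ↔ G.Contractible e :=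
  and_congr ne_comm or_comm

/-- Some ordinary vertex carries a loop that is its only inward or its only outward edge.  This property is inherited by contractions and excludes stability. -/
def HasTightLoop (G : PGraph) : Prop :=
  ∃ l : G.E, G.src l = G.tgt l ∧ G.src l ≠ G.pt ∧ (G.outDeg (G.src l) = 1 ∨ G.inDeg (G.src l) = 1)

theorem HasTightLoop.op {G : PGraph} (h : G.HasTightLoop) : G.op.HasTightLoop := by
  obtain ⟨l, h1, h2, h3⟩ := h
  refine ⟨l, h1.symm, ?_, ?_⟩
  · rw [h1] at h2
    exact h2
  · rw [h1] at h3
    exact h3.symm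

theorem Stable.not_hasTightLoop {G : PGraph} (h : G.Stable) : ¬ G.HasTightLoop := by
  rintro ⟨l, -, h2, h3⟩
  have := h _ h2
  omega

theorem Stable.not_contractible {G : PGraph} (h : G.Stable) (e : G.E) : ¬ G.Contractible e := by
  rintro ⟨-, h2 | h2⟩
  · have := h _ h2.1
    omega
  · have := h _ h2.1
    omega

theorem eq_of_outDeg_eq_one {G : PGraph} {v : G.V} (h : G.outDeg v = 1) {x y : G.E}
    (hx : G.src x = v) (hy : G.src y = v) : x = y := by
  have := (Nat.card_eq_one_iff_unique.1 h).1
  exact congrArg Subtype.val (Subsingleton.elim (⟨x, hx⟩ : {e // G.src e = v}) ⟨y, hy⟩)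

theorem eq_of_inDeg_eq_one {G : PGraph} {v : G.V} (h : G.inDeg v = 1) {x y : G.E}
    (hx : G.tgt x = v) (hy : G.tgt y = v) : x = y :=
  eq_of_outDeg_eq_one (G := G.op) h hx hy

theorem one_le_inDeg (G : PGraph) (x : G.E) : 1 ≤ G.inDeg (G.tgt x) :=
  Nat.card_pos_iff.2 ⟨⟨⟨x, rfl⟩⟩, inferInstance⟩

/-- `H` arises from `G` by contracting the edge `e`, with quotient map `q` on vertices and inclusion
`r` of the set of edges. -/
structure IsContraction (G : PGraph) (e : G.E) (H : PGraph) (q : G.V → H.V) (r : H.E → G.E) :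
    Prop where
  ne : G.src e ≠ G.tgt e
  surj : Function.Surjective q
  eq_iff : ∀ a b, q a = q b ↔
    a = b ∨ (a = G.src e ∨ a = G.tgt e) ∧ (b = G.src e ∨ b = G.tgt e)
  inj : Function.Injective r
  range_iff : ∀ x, (∃ y, r y = x) ↔ x ≠ e
  src : ∀ y, H.src y = q (G.src (r y))
  tgt : ∀ y, H.tgt y = q (G.tgt (r y))
  pt : H.pt = q G.pt

theorem isContraction_contract (G : PGraph) (e : G.E) (he : G.src e ≠ G.tgt e) :
    IsContraction G e (G.contract e) (Quot.mk _) Subtype.val where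
  ne := he
  surj := Quot.mk_surjective
  eq_iff a b := by
    refine Quot.eq.trans ?_
    constructor
    · intro h
      induction h with
      | rel x y h => exact Or.inr ⟨Or.inl h.1, Or.inr h.2⟩
      | refl => exact Or.inl rfl
      | symm _ _ _ ih => exact ih.imp Eq.symm And.symm
      | trans _ _ _ _ _ ih₁ ih₂ =>
        rcases ih₁ with rfl | ih₁
        · exact ih₂
        · rcases ih₂ with rfl | ih₂
          · exact Or.inr ih₁
          · exact Or.inr ⟨ih₁.1, ih₂.2⟩
    · have h : Relation.EqvGen (fun a b => a = G.src e ∧ b = G.tgt e) (G.src e) (G.tgt e) :=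
        .rel _ _ ⟨rfl, rfl⟩
      rintro (rfl | ⟨rfl | rfl, rfl | rfl⟩)
      exacts [.refl _, .refl _, h, .symm _ _ h, .refl _]
  inj := Subtype.val_injective
  range_iff x := ⟨by rintro ⟨y, rfl⟩; exact y.2, fun h => ⟨⟨x, h⟩, rfl⟩⟩
  src _ := rfl
  tgt _ := rfl
  pt := rfl

namespace IsContraction

variable {G : PGraph} {e : G.E} {H : PGraph} {q : G.V → H.V} {r : H.E → G.E}

/-- The advantage of the predicate over the construction `contract`: it is symmetric in the ends of
`e`, so each outward statement yields its inward counterpart. -/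
theorem op (h : IsContraction G e H q r) : IsContraction G.op e H.op q r where
  ne := h.ne.symm
  surj := h.surj
  eq_iff a b :=
    (h.eq_iff a b).trans (or_congr Iff.rfl (and_congr or_comm or_comm))
  inj := h.inj
  range_iff := h.range_iff
  src := h.tgt
  tgt := h.src
  pt := h.pt

theorem q_src_eq (h : IsContraction G e H q r) : q (G.src e) = q (G.tgt e) :=
  (h.eq_iff _ _).2 (Or.inr ⟨Or.inl rfl, Or.inr rfl⟩)

theorem card_V (h : IsContraction G e H q r) : Nat.card H.V + 1 = Nat.card G.V := by
  rw [← Nat.card_ne_add_one (G.src e)]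
  congr 1
  refine (Nat.card_congr (Equiv.ofBijective (fun a : {a // a ≠ G.src e} => q a) ⟨?_, ?_⟩)).symm
  · rintro ⟨a, ha⟩ ⟨b, hb⟩ hab
    have := (h.eq_iff a b).1 hab
    refine Subtype.ext ?_
    rcases this with h1 | ⟨h1, h2⟩
    · exact h1
    · exact (h1.resolve_left ha).trans (h2.resolve_left hb).symm
  · intro w
    obtain ⟨a, rfl⟩ := h.surj w
    by_cases ha : a = G.src e
    · exact ⟨⟨G.tgt e, h.ne.symm⟩, by rw [ha]; exact h.q_src_eq.symm⟩
    · exact ⟨⟨a, ha⟩, rfl⟩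

theorem card_E (h : IsContraction G e H q r) : Nat.card H.E + 1 = Nat.card G.E := by
  rw [← Nat.card_ne_add_one e]
  congr 1
  refine Nat.card_congr (Equiv.ofBijective (fun y => (⟨r y, (h.range_iff _).1 ⟨y, rfl⟩⟩ :
    {x // x ≠ e})) ⟨fun a b hab => h.inj (congrArg Subtype.val hab), fun x => ?_⟩)
  obtain ⟨y, hy⟩ := (h.range_iff _).2 x.2
  exact ⟨y, Subtype.ext hy⟩

theorem outDeg_eq (h : IsContraction G e H q r) (a : G.V) :
    H.outDeg (q a) = Set.ncard {x : G.E | x ≠ e ∧ q (G.src x) = q a} := by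
  have : {x : G.E | x ≠ e ∧ q (G.src x) = q a} = r '' {y | H.src y = q a} := by
    ext x
    simp only [Set.mem_ofPred_eq, Set.mem_image]
    constructor
    · rintro ⟨h1, h2⟩
      obtain ⟨y, rfl⟩ := (h.range_iff x).2 h1
      exact ⟨y, by rw [h.src, h2], rfl⟩
    · rintro ⟨y, h1, rfl⟩
      exact ⟨(h.range_iff _).1 ⟨y, rfl⟩, by rw [← h.src, h1]⟩
  rw [this, Set.ncard_image_of_injective _ h.inj]
  rfl

theorem outDeg_of_ne (h : IsContraction G e H q r) {a : G.V} (h1 : a ≠ G.src e)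
    (h2 : a ≠ G.tgt e) : H.outDeg (q a) = G.outDeg a := by
  rw [h.outDeg_eq]
  have : {x : G.E | x ≠ e ∧ q (G.src x) = q a} = {x | G.src x = a} := by
    ext x
    simp only [Set.mem_ofPred_eq, h.eq_iff]
    constructor
    · rintro ⟨-, h3 | ⟨-, h3 | h3⟩⟩
      exacts [h3, absurd h3 h1, absurd h3 h2]
    · rintro rfl
      exact ⟨fun h => h1 (by rw [h]), Or.inl rfl⟩
  rw [this]
  rfl

/-- The merged vertex inherits the outward edges of both ends, except `e` itself. -/
theorem outDeg_tgt (h : IsContraction G e H q r) :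
    H.outDeg (q (G.tgt e)) + 1 = G.outDeg (G.src e) + G.outDeg (G.tgt e) := by
  have h1 : {x : G.E | x ≠ e ∧ q (G.src x) = q (G.tgt e)} =
      ({x | G.src x = G.src e} ∪ {x | G.src x = G.tgt e}) \ {e} := by
    ext x
    simp only [Set.mem_ofPred_eq, h.eq_iff, Set.mem_sdiff, Set.mem_union, Set.mem_singleton_iff]
    tauto
  have h2 : Disjoint {x | G.src x = G.src e} {x | G.src x = G.tgt e} :=
    Set.disjoint_left.2 fun x hx hx' => h.ne (hx.symm.trans hx')
  have h3 : e ∈ {x | G.src x = G.src e} ∪ {x | G.src x = G.tgt e} := Or.inl rfl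
  rw [h.outDeg_eq, h1, Set.ncard_sdiff_singleton_add_one h3, Set.ncard_union_eq h2]
  rfl

theorem inDeg_of_ne (h : IsContraction G e H q r) {a : G.V} (h1 : a ≠ G.src e)
    (h2 : a ≠ G.tgt e) : H.inDeg (q a) = G.inDeg a :=
  h.op.outDeg_of_ne h2 h1

theorem inDeg_tgt (h : IsContraction G e H q r) :
    H.inDeg (q (G.tgt e)) + 1 = G.inDeg (G.src e) + G.inDeg (G.tgt e) := by
  rw [← h.q_src_eq, add_comm (G.inDeg _)]
  exact h.op.outDeg_tgt

/-- The relevant properties preserved by the contraction of a contractible edge. -/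
structure Preserves (G : PGraph) (H : PGraph) (r : H.E → G.E) : Prop where
  semistable : H.Semistable
  of_contractible : ∀ y, H.Contractible y → G.Contractible (r y)
  contractible : ∀ y, G.Contractible (r y) → H.src y ≠ H.tgt y → H.Contractible y
  tightLoop_of_contractible : ∀ y, G.Contractible (r y) → H.src y = H.tgt y → H.HasTightLoop
  tightLoop : G.HasTightLoop → H.HasTightLoop

/-- Let `e = uv`, with `u` ordinary of outward degree one, hence of inward degree at least two.
Contracting `e` leaves all outward degrees other than that of `u` unchanged, and the merged vertex,
which replaces `v`, has inward degree at least two. So the conditions that make an edge contractible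
do not change; the edge can only cease to be contractible by becoming a loop. -/
theorem preserves_of_outDeg (h : IsContraction G e H q r) (hG : G.Semistable)
    (hu : G.src e ≠ G.pt) (h1 : G.outDeg (G.src e) = 1) : Preserves G H r := by
  have hin : 2 ≤ G.inDeg (G.src e) := by have := hG _ hu; omega
  have htin := h.inDeg_tgt
  have hout : ∀ a, a ≠ G.src e → H.outDeg (q a) = G.outDeg a := fun a ha => by
    by_cases hb : a = G.tgt e
    · rw [hb]; have := h.outDeg_tgt; omega
    · exact h.outDeg_of_ne ha hb
  have hpt : ∀ a, a ≠ G.src e → (q a = H.pt ↔ a = G.pt) := fun a ha => by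
    rw [h.pt, h.eq_iff]
    constructor
    · rintro (h2 | ⟨h2, h3⟩)
      · exact h2
      · exact (h2.resolve_left ha).trans (h3.resolve_left hu.symm).symm
    · exact Or.inl
  have hsrc : ∀ y, G.src (r y) ≠ G.src e := fun y hy =>
    (h.range_iff _).1 ⟨y, rfl⟩ (eq_of_outDeg_eq_one h1 hy rfl)
  have htin' : 2 ≤ H.inDeg (q (G.tgt e)) := by have := G.one_le_inDeg e; omega
  have hin1 : ∀ y, G.inDeg (G.tgt (r y)) = 1 → G.tgt (r y) ≠ G.src e ∧ G.tgt (r y) ≠ G.tgt e :=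
    fun y hy => ⟨fun h2 => by rw [h2] at hy; omega, fun h2 =>
      (h.range_iff _).1 ⟨y, rfl⟩ (eq_of_inDeg_eq_one hy rfl h2.symm)⟩
  refine ⟨?_, ?_, ?_, ?_, ?_⟩
  · have key : ∀ a, a ≠ G.src e → q a ≠ H.pt →
        1 ≤ H.inDeg (q a) ∧ 1 ≤ H.outDeg (q a) ∧ 3 ≤ H.inDeg (q a) + H.outDeg (q a) := by
      intro a ha hp
      have h2 := hG a fun h2 => hp ((hpt a ha).2 h2)
      rw [hout a ha]
      by_cases hb : a = G.tgt e
      · subst hb; omega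
      · rwa [h.inDeg_of_ne ha hb]
    intro w hw
    obtain ⟨a, rfl⟩ := h.surj w
    by_cases ha : a = G.src e
    · subst ha
      rw [h.q_src_eq] at hw ⊢
      exact key _ h.ne.symm hw
    · exact key a ha hw
  · rintro y ⟨h2, h3⟩
    refine ⟨fun h4 => h2 (by rw [h.src, h.tgt, h4]), ?_⟩
    rcases h3 with ⟨h3, h4⟩ | ⟨h3, h4⟩
    · rw [h.src] at h3 h4
      rw [hout _ (hsrc y)] at h4
      exact Or.inl ⟨fun h5 => h3 ((hpt _ (hsrc y)).2 h5), h4⟩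
    · rw [h.tgt] at h3 h4
      have h5 : G.tgt (r y) ≠ G.tgt e := fun h5 => by rw [h5] at h4; omega
      have h6 : G.tgt (r y) ≠ G.src e := fun h5 => by rw [h5, h.q_src_eq] at h4; omega
      rw [h.inDeg_of_ne h6 h5] at h4
      exact Or.inr ⟨fun h7 => h3 ((hpt _ h6).2 h7), h4⟩
  · rintro y ⟨-, h3⟩ h2
    refine ⟨h2, ?_⟩
    rw [h.src, h.tgt]
    rcases h3 with ⟨h3, h4⟩ | ⟨h3, h4⟩
    · exact Or.inl ⟨fun h5 => h3 ((hpt _ (hsrc y)).1 h5), by rw [hout _ (hsrc y), h4]⟩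
    · obtain ⟨h5, h6⟩ := hin1 y h4
      exact Or.inr ⟨fun h7 => h3 ((hpt _ h5).1 h7), by rw [h.inDeg_of_ne h5 h6, h4]⟩
  -- An edge that becomes a loop runs from `v` back to `u`. As `u` has inward degree at least two,
  -- its contractibility came from `v` having outward degree one, which makes the new loop tight.
  · rintro y ⟨h2, h3⟩ h4
    rw [h.src, h.tgt, h.eq_iff] at h4
    obtain ⟨h5, h6⟩ := h4.resolve_left h2
    replace h5 := h5.resolve_left (hsrc y)
    replace h6 := h6.resolve_right fun h6 => h2 (h5.trans h6.symm)
    have h7 : H.src y = q (G.tgt e) := by rw [h.src, h5]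
    rcases h3 with ⟨h8, h9⟩ | ⟨-, h9⟩
    · refine ⟨y, ?_, ?_, Or.inl ?_⟩
      · rw [h7, h.tgt, h6, h.q_src_eq]
      · rw [h7, Ne, hpt _ h.ne.symm, ← h5]
        exact h8
      · rw [h7, hout _ h.ne.symm, ← h5, h9]
    · exact absurd h6 (hin1 y h9).1
  · rintro ⟨l, h2, h3, h4⟩
    obtain ⟨y, rfl⟩ := (h.range_iff l).2 fun h5 => h.ne (h5 ▸ h2)
    refine ⟨y, by rw [h.src, h.tgt, h2], ?_, ?_⟩
    · rwa [h.src, Ne, hpt _ (hsrc y)]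
    · rw [h.src]
      rcases h4 with h4 | h4
      · exact Or.inl (by rw [hout _ (hsrc y), h4])
      · rw [h2] at h4 ⊢
        obtain ⟨h5, h6⟩ := hin1 y h4
        exact Or.inr (by rw [h.inDeg_of_ne h5 h6, h4])

theorem Preserves.of_op (h : Preserves G.op H.op r) : Preserves G H r where
  semistable := h.semistable.op
  of_contractible y hy := contractible_op.1 (h.of_contractible y (contractible_op.2 hy))
  contractible y hy hn := contractible_op.1 (h.contractible y (contractible_op.2 hy) hn.symm)
  tightLoop_of_contractible y hy hn :=
    (h.tightLoop_of_contractible y (contractible_op.2 hy) hn.symm).op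
  tightLoop hl := (h.tightLoop hl.op).op

theorem preserves (h : IsContraction G e H q r) (hG : G.Semistable) (he : G.Contractible e) :
    Preserves G H r := by
  rcases he.2 with h1 | h1
  · exact h.preserves_of_outDeg hG h1.1 h1.2
  · exact (h.op.preserves_of_outDeg hG.op h1.1 h1.2).of_op

end IsContraction

/-! ### Collapses and their equivalence with stabilization. -/

/-- Adjacency along contractible edges. -/
def ContrAdj (G : PGraph) (a b : G.V) : Prop :=
  ∃ x, G.Contractible x ∧ G.src x = a ∧ G.tgt x = b

/-- `q` identifies only the ends of `e`, which were already joined by a contractible edge. This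
carries the fibre condition of a collapse through one contraction, in both directions. -/
theorem IsContraction.eqvGen_iff {G : PGraph} {e : G.E} {H : PGraph} {q : G.V → H.V}
    {r : H.E → G.E} (h : IsContraction G e H q r) (he : G.Contractible e)
    (hC : ∀ y, H.Contractible y ↔ G.Contractible (r y)) (a b : G.V) :
    Relation.EqvGen H.ContrAdj (q a) (q b) ↔ Relation.EqvGen G.ContrAdj a b := by
  have he' : Relation.EqvGen G.ContrAdj (G.src e) (G.tgt e) := .rel _ _ ⟨e, he, rfl, rfl⟩
  have hq : ∀ a b, q a = q b → Relation.EqvGen G.ContrAdj a b := fun a b hab => by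
    rcases (h.eq_iff a b).1 hab with rfl | ⟨rfl | rfl, rfl | rfl⟩
    exacts [.refl _, .refl _, he', .symm _ _ he', .refl _]
  constructor
  · intro hab
    generalize hc : q a = c at hab
    generalize hd : q b = d at hab
    induction hab generalizing a b with
    | rel x y hxy =>
      obtain ⟨z, hz, rfl, rfl⟩ := hxy
      rw [h.src] at hc
      rw [h.tgt] at hd
      exact .trans _ _ _ (hq _ _ hc) (.trans _ _ _ (.rel _ _ ⟨r z, (hC z).1 hz, rfl, rfl⟩)
        (hq _ _ hd.symm))
    | refl x => exact hq _ _ (hc.trans hd.symm)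
    | symm _ _ _ ih => exact .symm _ _ (ih b a hd hc)
    | trans x y z _ _ ih₁ ih₂ =>
      obtain ⟨m, hm⟩ := h.surj y
      exact .trans _ _ _ (ih₁ a m hc hm) (ih₂ m b hm hd)
  · intro hab
    induction hab with
    | rel x y hxy =>
      obtain ⟨z, hz, rfl, rfl⟩ := hxy
      by_cases hze : z = e
      · rw [hze, h.q_src_eq]
        exact .refl _
      · obtain ⟨y, rfl⟩ := (h.range_iff z).2 hze
        exact .rel _ _ ⟨y, (hC y).2 hz, h.src y, h.tgt y⟩
    | refl => exact .refl _
    | symm _ _ _ ih => exact .symm _ _ ih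
    | trans _ _ _ _ _ ih₁ ih₂ => exact .trans _ _ _ ih₁ ih₂

/-- A map from `Z` to `G` that contracts exactly the contractible edges of `Z`. -/
@[ext]
structure Collapse (Z G : PGraph) where
  v : Z.V → G.V
  e : G.E → Z.E
  surj : Function.Surjective v
  eq_iff : ∀ a b, v a = v b ↔ Relation.EqvGen Z.ContrAdj a b
  inj : Function.Injective e
  range_iff : ∀ x, (∃ y, e y = x) ↔ ¬ Z.Contractible x
  src : ∀ y, G.src y = v (Z.src (e y))
  tgt : ∀ y, G.tgt y = v (Z.tgt (e y))
  pt : G.pt = v Z.pt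

theorem eqvGen_contrAdj_iff_of_forall_not {G : PGraph} (h : ∀ e, ¬ G.Contractible e) (a b : G.V) :
    Relation.EqvGen G.ContrAdj a b ↔ a = b := by
  constructor
  · intro hab
    induction hab with
    | rel x y hxy => obtain ⟨z, hz, -⟩ := hxy; exact absurd hz (h z)
    | refl => rfl
    | symm _ _ _ ih => exact ih.symm
    | trans _ _ _ _ _ ih₁ ih₂ => exact ih₁.trans ih₂
  · rintro rfl
    exact .refl _

theorem Iso.outDeg {G H : PGraph} (f : Iso G H) (a : G.V) : H.outDeg (f.v a) = G.outDeg a :=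
  (Nat.card_congr (f.e.subtypeEquiv fun x => by rw [f.src, f.v.apply_eq_iff_eq])).symm

theorem Iso.inDeg {G H : PGraph} (f : Iso G H) (a : G.V) : H.inDeg (f.v a) = G.inDeg a :=
  (Nat.card_congr (f.e.subtypeEquiv fun x => by rw [f.tgt, f.v.apply_eq_iff_eq])).symm

theorem Iso.contractible {G H : PGraph} (f : Iso G H) (x : G.E) :
    H.Contractible (f.e x) ↔ G.Contractible x := by
  simp only [Contractible, f.src, f.tgt, f.outDeg, f.inDeg, ← f.pt, Ne, f.v.apply_eq_iff_eq]

theorem Iso.semistable {G H : PGraph} (f : Iso G H) (h : G.Semistable) : H.Semistable := by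
  intro w hw
  obtain ⟨a, rfl⟩ := f.v.surjective w
  rw [f.outDeg, f.inDeg]
  exact h a fun ha => hw (by rw [ha, f.pt])

theorem Iso.weight {G H : PGraph} (f : Iso G H) : H.weight = G.weight := by
  rw [weight_eq, weight_eq, Nat.card_congr f.v, Nat.card_congr f.e]

theorem Iso.hasTightLoop {G H : PGraph} (f : Iso G H) (h : G.HasTightLoop) : H.HasTightLoop := by
  obtain ⟨l, h1, h2, h3⟩ := h
  refine ⟨f.e l, by rw [f.src, f.tgt, h1], ?_, ?_⟩
  · rw [f.src, ← f.pt, Ne, f.v.apply_eq_iff_eq]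
    exact h2
  · rwa [f.src, f.outDeg, f.inDeg]

/-- A semistable graph that contracts to a stable graph collapses onto it. -/
theorem ContractsTo.nonempty_collapse {Z G : PGraph} (h : ContractsTo Z G) (hZ : Z.Semistable)
    (hG : G.Stable) : ¬ Z.HasTightLoop ∧ Nonempty (Collapse Z G) := by
  induction h with
  | @of_iso Z G h =>
    obtain ⟨f⟩ := h
    have hc : ∀ e, ¬ Z.Contractible e := fun e he =>
      hG.not_contractible _ ((f.contractible e).2 he)
    refine ⟨fun hl => hG.not_hasTightLoop (f.hasTightLoop hl), ⟨⟨f.v, f.e.symm, f.v.surjective,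
      fun a b => ?_, f.e.symm.injective, fun x => ?_, fun y => ?_, fun y => ?_, f.pt.symm⟩⟩⟩
    · rw [eqvGen_contrAdj_iff_of_forall_not hc, f.v.apply_eq_iff_eq]
    · exact iff_of_true (f.e.symm.surjective x) (hc x)
    · rw [← f.src, f.e.apply_symm_apply]
    · rw [← f.tgt, f.e.apply_symm_apply]
  | @step Z G e he h ih =>
    have hq := Z.isContraction_contract e he.1
    have hp := hq.preserves hZ he
    obtain ⟨h1, ⟨μ⟩⟩ := ih hp.semistable hG
    -- A contractible edge of `Z` turned into a loop would yield a tight loop in the contraction,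
    -- which `h1` rules out.
    have hC : ∀ y : (Z.contract e).E, (Z.contract e).Contractible y ↔ Z.Contractible y.1 :=
      fun y => ⟨hp.of_contractible y, fun hy => hp.contractible y hy
        fun hn => h1 (hp.tightLoop_of_contractible y hy hn)⟩
    refine ⟨fun hl => h1 (hp.tightLoop hl), ⟨⟨fun a => μ.v (Quot.mk _ a), fun y => (μ.e y).1,
      μ.surj.comp hq.surj, fun a b => ?_, Subtype.val_injective.comp μ.inj, fun x => ?_,
      fun y => μ.src y, fun y => μ.tgt y, μ.pt⟩⟩⟩
    · exact (μ.eq_iff _ _).trans (hq.eqvGen_iff he hC a b)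
    · constructor
      · rintro ⟨y, rfl⟩ hy
        exact (μ.range_iff _).1 ⟨y, rfl⟩ ((hC _).2 hy)
      · intro hx
        obtain ⟨y, hy⟩ := (μ.range_iff ⟨x, fun h => hx (h ▸ he)⟩).2 fun h => hx ((hC _).1 h)
        exact ⟨y, congrArg Subtype.val hy⟩

namespace Collapse

variable {Z G : PGraph}

theorem card_E (μ : Collapse Z G) :
    Nat.card Z.E = Nat.card G.E + Nat.card {x // Z.Contractible x} := by
  have h1 : Nat.card G.E = Nat.card {x // ¬ Z.Contractible x} :=
    Nat.card_congr (Equiv.ofBijective (fun y => (⟨μ.e y, (μ.range_iff _).1 ⟨y, rfl⟩⟩ :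
      {x // ¬ Z.Contractible x})) ⟨fun a b h => μ.inj (congrArg Subtype.val h), fun x => by
        obtain ⟨y, hy⟩ := (μ.range_iff _).2 x.2
        exact ⟨y, Subtype.ext hy⟩⟩)
  classical
  rw [h1, add_comm, ← Nat.card_sum]
  exact (Nat.card_congr (Equiv.sumCompl _)).symm

/-- As the vertices of `G` are the components of the contractible edges, this count says that these
edges form a forest. -/
theorem card_V (μ : Collapse Z G) (hw : Z.weight = G.weight) :
    Nat.card Z.V = Nat.card G.V + Nat.card {x // Z.Contractible x} := by
  have := μ.card_E
  rw [weight_eq, weight_eq] at hw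
  omega

/-- The contractible edges form a forest, so contracting one of them turns no other into a loop. The
rest stay contractible, and induction on the number of edges applies. -/
theorem contractsTo (μ : Collapse Z G) (hZ : Z.Semistable) (hw : Z.weight = G.weight) :
    ContractsTo Z G := by
  induction hn : Nat.card Z.E using Nat.strong_induction_on generalizing Z with
  | _ n ih =>
  by_cases hc : ∀ e, ¬ Z.Contractible e
  · refine .of_iso ⟨⟨Equiv.ofBijective μ.v ⟨fun a b hab => ?_, μ.surj⟩,
      (Equiv.ofBijective μ.e ⟨μ.inj, fun x => (μ.range_iff x).2 (hc x)⟩).symm, fun x => ?_,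
      fun x => ?_, μ.pt.symm⟩⟩
    · rwa [μ.eq_iff, eqvGen_contrAdj_iff_of_forall_not hc] at hab
    · rw [μ.src]
      exact congrArg (fun x => μ.v (Z.src x)) ((Equiv.ofBijective μ.e _).apply_symm_apply x)
    · rw [μ.tgt]
      exact congrArg (fun x => μ.v (Z.tgt x)) ((Equiv.ofBijective μ.e _).apply_symm_apply x)
  · push Not at hc
    obtain ⟨e, he⟩ := hc
    have hq := Z.isContraction_contract e he.1
    have hp := hq.preserves hZ he
    have hloop : ∀ y : (Z.contract e).E, Z.Contractible y.1 →
        (Z.contract e).src y ≠ (Z.contract e).tgt y := by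
      rintro ⟨f, hf⟩ hfc hl
      have hef := (hq.eq_iff (Z.src f) (Z.tgt f)).1 hl
      -- If `f` became a loop it would join the two ends of `e`, so the fibres would stay connected
      -- without `f`. That leaves one edge too few for `μ.card_V`.
      have hbound := card_le_card_add_card_of_connected
        (fun x : {x : {x // Z.Contractible x} // x ≠ ⟨f, hfc⟩} => Z.src x.1.1)
        (fun x => Z.tgt x.1.1) μ.v fun a b hab => by
          rw [μ.eq_iff] at hab
          have hstep : ∀ x, Z.Contractible x → x ≠ f → Relation.EqvGen (fun a b =>
              ∃ x : {x : {x // Z.Contractible x} // x ≠ ⟨f, hfc⟩},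
                Z.src x.1.1 = a ∧ Z.tgt x.1.1 = b) (Z.src x) (Z.tgt x) := fun x hx hxf =>
            .rel _ _ ⟨⟨⟨x, hx⟩, fun h => hxf (congrArg Subtype.val h)⟩, rfl, rfl⟩
          induction hab with
          | rel x y hxy =>
            obtain ⟨z, hz, rfl, rfl⟩ := hxy
            by_cases hzf : z = f
            · have h1 := hstep e he (Ne.symm hf)
              rw [hzf]
              rcases hef.resolve_left hfc.1 with ⟨h2 | h2, h3 | h3⟩ <;> rw [h2, h3]
              exacts [.refl _, h1, .symm _ _ h1, .refl _]
            · exact hstep z hz hzf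
          | refl => exact .refl _
          | symm _ _ _ ih => exact .symm _ _ ih
          | trans _ _ _ _ _ ih₁ ih₂ => exact .trans _ _ _ ih₁ ih₂
      have h1 := μ.card_V hw
      have h2 := Nat.card_ne_add_one (⟨f, hfc⟩ : {x // Z.Contractible x})
      omega
    have hC : ∀ y : (Z.contract e).E, (Z.contract e).Contractible y ↔ Z.Contractible y.1 :=
      fun y => ⟨hp.of_contractible y, fun hy => hp.contractible y hy (hloop y hy)⟩
    have hne : ∀ y, μ.e y ≠ e := fun y hy => (μ.range_iff _).1 ⟨y, hy⟩ he
    have hve : ∀ a b, a = Z.src e ∧ b = Z.tgt e → μ.v a = μ.v b := by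
      rintro a b ⟨rfl, rfl⟩
      exact (μ.eq_iff _ _).2 (.rel _ _ ⟨e, he, rfl, rfl⟩)
    have hcE := hq.card_E
    have hcV := hq.card_V
    refine .step e he (ih (Nat.card (Z.contract e).E) (by omega) ⟨Quot.lift μ.v hve,
      fun y => ⟨μ.e y, hne y⟩, fun w => ?_, ?_, fun a b hab => μ.inj (congrArg Subtype.val hab),
      fun x => ?_, μ.src, μ.tgt, μ.pt⟩ hp.semistable ?_ rfl)
    · obtain ⟨a, rfl⟩ := μ.surj w
      exact ⟨Quot.mk _ a, rfl⟩
    · rintro ⟨a⟩ ⟨b⟩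
      exact (μ.eq_iff a b).trans (hq.eqvGen_iff he hC a b).symm
    · rw [hC, ← μ.range_iff]
      exact exists_congr fun y => Subtype.ext_iff
    · rw [weight_eq] at hw ⊢
      omega

/-- This trades a sequence of contractions, taken in some order, for a single map. -/
theorem nonempty_iff (hZ : Z.Semistable) (hG : G.Stable) (hw : Z.weight = G.weight) :
    Nonempty (Collapse Z G) ↔ Z.HasStabilization G :=
  ⟨fun ⟨μ⟩ => ⟨hZ, hG, μ.contractsTo hZ hw⟩, fun h => (h.2.2.nonempty_collapse hZ hG).2⟩

end Collapse

end PGraph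

/-! ### Legs at vertices of degree one in contractible trees. -/

namespace DecTree

variable {P : Prop} {A B : Type}

theorem nonempty_V (T : DecTree P A B) : Nonempty T.V :=
  (Nat.card_pos_iff.1 (by rw [T.card_eq]; omega)).1

/-- The decorated tree with all edges and legs reversed. -/
def op (T : DecTree P A B) : DecTree P B A where
  V := T.V
  E := T.E
  src := T.tgt
  tgt := T.src
  outLeg := T.inLeg
  inLeg := T.outLeg
  pt := T.pt
  connected x y := by
    induction T.connected x y with
    | rel x y h => obtain ⟨e, h1, h2⟩ := h; exact .symm _ _ (.rel _ _ ⟨e, h2, h1⟩)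
    | refl => exact .refl _
    | symm _ _ _ ih => exact .symm _ _ ih
    | trans _ _ _ _ _ ih₁ ih₂ => exact .trans _ _ _ ih₁ ih₂
  card_eq := T.card_eq

theorem Semistable.op {T : DecTree P A B} (h : T.Semistable) : T.op.Semistable := fun v hv =>
  ⟨(h v hv).2.1, (h v hv).1, by rw [add_comm]; exact (h v hv).2.2⟩

theorem Contractible.op {T : DecTree P A B} (h : T.Contractible) : T.op.Contractible := fun e =>
  ⟨(h e).1.symm, (h e).2.symm⟩

section

variable {T : DecTree P A B}

theorem two_le_outDeg_of_edge_of_leg [Finite A] (e : T.E) (l : A) (h : T.src e = T.outLeg l) :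
    2 ≤ T.outDeg (T.outLeg l) := by
  have h1 : 0 < Nat.card {e // T.src e = T.outLeg l} :=
    Nat.card_pos_iff.2 ⟨⟨⟨e, h⟩⟩, inferInstance⟩
  have h2 : 0 < Nat.card {a // T.outLeg a = T.outLeg l} :=
    Nat.card_pos_iff.2 ⟨⟨⟨l, rfl⟩⟩, inferInstance⟩
  rw [outDeg]
  omega

theorem eq_of_src_eq_of_outDeg_eq_one {v : T.V} (h : T.outDeg v = 1) {x y : T.E}
    (hx : T.src x = v) (hy : T.src y = v) : x = y := by
  have h1 : Nat.card {e // T.src e = v} ≤ 1 := by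
    rw [outDeg] at h
    omega
  have := Finite.card_le_one_iff_subsingleton.1 h1
  exact congrArg Subtype.val (Subsingleton.elim (⟨x, hx⟩ : {e // T.src e = v}) ⟨y, hy⟩)

theorem eq_of_outLeg_eq_of_outDeg_eq_one [Finite A] {v : T.V} (h : T.outDeg v = 1) {x y : A}
    (hx : T.outLeg x = v) (hy : T.outLeg y = v) : x = y := by
  have h1 : Nat.card {a // T.outLeg a = v} ≤ 1 := by
    rw [outDeg] at h
    omega
  have := Finite.card_le_one_iff_subsingleton.1 h1
  exact congrArg Subtype.val (Subsingleton.elim (⟨x, hx⟩ : {a // T.outLeg a = v}) ⟨y, hy⟩)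

/-- If the only outward half-edge at an ordinary vertex of a contractible tree is a leg, then the
tree is not pointed and has no other outward leg. -/
theorem subsingleton_of_outDeg_outLeg_eq_one [Finite A] (hT : T.Semistable) (hc : T.Contractible) (l : A)
    (ho : T.IsOrdinary (T.outLeg l)) (h1 : T.outDeg (T.outLeg l) = 1) : ¬ P ∧ ∀ l', l' = l := by
  let R : T.V → T.V → Prop := fun a b => ∃ e, T.src e = a ∧ T.tgt e = b
  let X : T.V → Prop := fun x => Relation.ReflTransGen R x (T.outLeg l)
  -- Backwards along a path: an ordinary vertex of outward degree one has inward degree at least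
  -- two, so an edge entering it is contractible only through its source.
  have hX : ∀ x, X x → T.IsOrdinary x ∧ T.outDeg x = 1 := fun x hx => by
    induction hx using Relation.ReflTransGen.head_induction_on with
    | refl => exact ⟨ho, h1⟩
    | head hxy _ ih =>
      obtain ⟨c, rfl, rfl⟩ := hxy
      refine (hc c).2.resolve_right fun h2 => ?_
      have := hT _ ih.1
      omega
  -- The only outward half-edge of a vertex in `X` is the leg `l` or the first edge of its path, so
  -- `X` is also closed under going forwards. By connectedness it is the whole tree.
  have hedge : ∀ c, X (T.src c) = X (T.tgt c) := fun c => by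
    refine propext ⟨fun hx => ?_, fun hx => .head ⟨c, rfl, rfl⟩ hx⟩
    have h2 := (hX _ hx).2
    rcases Relation.ReflTransGen.cases_head hx with h3 | ⟨y, ⟨c', hc', rfl⟩, hy⟩
    · have := two_le_outDeg_of_edge_of_leg c l h3
      omega
    · rwa [eq_of_src_eq_of_outDeg_eq_one h2 rfl hc']
  have hall : ∀ x, X x := fun x => by
    rw [eq_of_eqvGen_edges hedge (T.connected x (T.outLeg l))]
  refine ⟨fun hP => (hX _ (hall (T.pt hP))).1 hP rfl, fun l' => ?_⟩
  have h2 := (hX _ (hall (T.outLeg l'))).2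
  rcases Relation.ReflTransGen.cases_head (hall (T.outLeg l')) with h3 | ⟨y, ⟨c, h3, -⟩, -⟩
  · exact eq_of_outLeg_eq_of_outDeg_eq_one h1 h3 rfl
  · have := two_le_outDeg_of_edge_of_leg c l' h3
    omega

theorem subsingleton_of_inDeg_inLeg_eq_one [Finite B] (hT : T.Semistable) (hc : T.Contractible) (l : B)
    (ho : T.IsOrdinary (T.inLeg l)) (h1 : T.inDeg (T.inLeg l) = 1) : ¬ P ∧ ∀ l', l' = l :=
  T.op.subsingleton_of_outDeg_outLeg_eq_one hT.op hc.op l ho h1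

end

end DecTree

/-! ### Substitution of trees into a graph. -/

namespace PGraph

/-- A choice of a decorated tree for every vertex, with the half-edges at the vertex as legs. -/
abbrev TreeFamily (G : PGraph) : Type 1 :=
  ∀ v : G.V, DecTree (v = G.pt) {e : G.E // G.src e = v} {e : G.E // G.tgt e = v}

namespace TreeFamily

variable {G : PGraph}

section Degrees

variable (T : G.TreeFamily)

theorem outDeg_substitute (v : G.V) (a : (T v).V) :
    (G.substitute T).outDeg ⟨v, a⟩ = (T v).outDeg a := by
  rw [DecTree.outDeg, ← Nat.card_sum]
  refine (Nat.card_congr (Equiv.ofBijective (Sum.elim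
    (fun e => ⟨Sum.inr ⟨v, e.1⟩, congrArg (Sigma.mk v) e.2⟩)
    (fun l => ⟨Sum.inl l.1.1, by obtain ⟨⟨e, rfl⟩, rfl⟩ := l; rfl⟩)) ⟨?_, ?_⟩)).symm
  · rintro (⟨e, he⟩ | ⟨⟨e, he⟩, he'⟩) (⟨f, hf⟩ | ⟨⟨f, hf⟩, hf'⟩) h
    · cases Subtype.ext_iff.1 h; rfl
    · cases Subtype.ext_iff.1 h
    · cases Subtype.ext_iff.1 h
    · cases Subtype.ext_iff.1 h; rfl
  · rintro ⟨e | ⟨w, e⟩, h⟩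
    · cases h
      exact ⟨Sum.inr ⟨⟨e, rfl⟩, rfl⟩, rfl⟩
    · cases h
      exact ⟨Sum.inl ⟨e, rfl⟩, rfl⟩

theorem inDeg_substitute (v : G.V) (a : (T v).V) :
    (G.substitute T).inDeg ⟨v, a⟩ = (T v).inDeg a := by
  rw [DecTree.inDeg, ← Nat.card_sum]
  refine (Nat.card_congr (Equiv.ofBijective (Sum.elim
    (fun e => ⟨Sum.inr ⟨v, e.1⟩, congrArg (Sigma.mk v) e.2⟩)
    (fun l => ⟨Sum.inl l.1.1, by obtain ⟨⟨e, rfl⟩, rfl⟩ := l; rfl⟩)) ⟨?_, ?_⟩)).symm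
  · rintro (⟨e, he⟩ | ⟨⟨e, he⟩, he'⟩) (⟨f, hf⟩ | ⟨⟨f, hf⟩, hf'⟩) h
    · cases Subtype.ext_iff.1 h; rfl
    · cases Subtype.ext_iff.1 h
    · cases Subtype.ext_iff.1 h
    · cases Subtype.ext_iff.1 h; rfl
  · rintro ⟨e | ⟨w, e⟩, h⟩
    · cases h
      exact ⟨Sum.inr ⟨⟨e, rfl⟩, rfl⟩, rfl⟩
    · cases h
      exact ⟨Sum.inl ⟨e, rfl⟩, rfl⟩

theorem ne_pt_substitute_iff (v : G.V) (a : (T v).V) :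
    (⟨v, a⟩ : (G.substitute T).V) ≠ (G.substitute T).pt ↔ (T v).IsOrdinary a := by
  constructor
  · rintro h rfl rfl
    exact h rfl
  · intro h h'
    obtain ⟨rfl, h2⟩ := Sigma.mk.inj_iff.1 h'
    exact h rfl (eq_of_heq h2)

theorem semistable_substitute_iff :
    (G.substitute T).Semistable ↔ ∀ v, (T v).Semistable := by
  constructor
  · intro h v a ha
    rw [← outDeg_substitute, ← inDeg_substitute]
    exact h _ ((T.ne_pt_substitute_iff v a).2 ha)
  · rintro h ⟨v, a⟩ ha
    rw [outDeg_substitute, inDeg_substitute]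
    exact h v a ((T.ne_pt_substitute_iff v a).1 ha)

theorem contractible_inr_iff (v : G.V) (x : (T v).E) :
    (G.substitute T).Contractible (Sum.inr ⟨v, x⟩) ↔ (T v).src x ≠ (T v).tgt x ∧
      (((T v).IsOrdinary ((T v).src x) ∧ (T v).outDeg ((T v).src x) = 1) ∨
        ((T v).IsOrdinary ((T v).tgt x) ∧ (T v).inDeg ((T v).tgt x) = 1)) := by
  rw [← T.ne_pt_substitute_iff, ← T.ne_pt_substitute_iff, ← outDeg_substitute, ← inDeg_substitute]
  refine and_congr (not_congr ?_) Iff.rfl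
  exact ⟨fun h => eq_of_heq (Sigma.mk.inj_iff.1 h).2, fun h => congrArg (Sigma.mk v) h⟩

/-- Each tree has one edge fewer than vertices and replaces a single vertex. -/
theorem weight_substitute : (G.substitute T).weight = G.weight := by
  have := Fintype.ofFinite G.V
  have h1 : Nat.card (G.substitute T).V = ∑ v, Nat.card (T v).V := Nat.card_sigma
  have h2 : Nat.card (G.substitute T).E = Nat.card G.E + ∑ v, Nat.card (T v).E := by
    rw [← Nat.card_sigma, ← Nat.card_sum]
    rfl
  have h3 : ∑ v, Nat.card (T v).V = ∑ v, Nat.card (T v).E + Nat.card G.V := by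
    simp [DecTree.card_eq, Finset.sum_add_distrib]
  rw [weight_eq, weight_eq, h1, h2, h3]
  push_cast
  ring

end Degrees

/-- Otherwise the leg `e` would be the only half-edge on its side at an ordinary vertex of a tree.
That tree would be unpointed with a single leg on this side, against stability of the vertex of `G`
it replaces. -/
theorem not_contractible_inl {T : G.TreeFamily} (hG : G.Stable) (hs : ∀ v, (T v).Semistable)
    (hc : ∀ v, (T v).Contractible) (e : G.E) : ¬ (G.substitute T).Contractible (Sum.inl e) := by
  rintro ⟨-, h | h⟩
  · have h1 := (T.ne_pt_substitute_iff (G.src e) ((T (G.src e)).outLeg ⟨e, rfl⟩)).1 h.1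
    have h2 := (T.outDeg_substitute (G.src e) ((T (G.src e)).outLeg ⟨e, rfl⟩)).symm.trans h.2
    obtain ⟨h3, h4⟩ := DecTree.subsingleton_of_outDeg_outLeg_eq_one (hs _) (hc _) _ h1 h2
    have h5 : G.outDeg (G.src e) ≤ 1 := Finite.card_le_one_iff_subsingleton.2
      ⟨fun a b => (h4 a).trans (h4 b).symm⟩
    have := (hG _ h3).2
    omega
  · have h1 := (T.ne_pt_substitute_iff (G.tgt e) ((T (G.tgt e)).inLeg ⟨e, rfl⟩)).1 h.1
    have h2 := (T.inDeg_substitute (G.tgt e) ((T (G.tgt e)).inLeg ⟨e, rfl⟩)).symm.trans h.2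
    obtain ⟨h3, h4⟩ := DecTree.subsingleton_of_inDeg_inLeg_eq_one (hs _) (hc _) _ h1 h2
    have h5 : G.inDeg (G.tgt e) ≤ 1 := Finite.card_le_one_iff_subsingleton.2
      ⟨fun a b => (h4 a).trans (h4 b).symm⟩
    have := (hG _ h3).1
    omega

/-- The collapse of a graph obtained by substituting contractible trees into a stable graph. -/
def collapse (T : G.TreeFamily) (hG : G.Stable) (hs : ∀ v, (T v).Semistable)
    (hc : ∀ v, (T v).Contractible) : Collapse (G.substitute T) G where
  v := Sigma.fst
  e := Sum.inl
  surj v := ⟨⟨v, (T v).nonempty_V.some⟩, rfl⟩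
  eq_iff := by
    rintro ⟨v, a⟩ ⟨w, b⟩
    constructor
    · rintro (rfl : v = w)
      induction (T v).connected a b with
      | rel x y h =>
        obtain ⟨e, rfl, rfl⟩ := h
        exact .rel _ _ ⟨Sum.inr ⟨v, e⟩, (T.contractible_inr_iff v e).2 (hc v e), rfl, rfl⟩
      | refl => exact .refl _
      | symm _ _ _ ih => exact .symm _ _ ih
      | trans _ _ _ _ _ ih₁ ih₂ => exact .trans _ _ _ ih₁ ih₂
    · generalize (⟨v, a⟩ : (G.substitute T).V) = x
      generalize (⟨w, b⟩ : (G.substitute T).V) = y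
      intro h
      induction h with
      | rel x y h =>
        obtain ⟨e | e, he, rfl, rfl⟩ := h
        · exact absurd he (not_contractible_inl hG hs hc e)
        · rfl
      | refl => rfl
      | symm _ _ _ ih => exact ih.symm
      | trans _ _ _ _ _ ih₁ ih₂ => exact ih₁.trans ih₂
  inj := Sum.inl_injective
  range_iff := by
    rintro (e | ⟨v, e⟩)
    · exact iff_of_true ⟨e, rfl⟩ (not_contractible_inl hG hs hc e)
    · exact iff_of_false (by rintro ⟨y, hy⟩; cases hy)
        (not_not.2 ((T.contractible_inr_iff v e).2 (hc v e)))
  src _ := rfl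
  tgt _ := rfl
  pt := rfl

/-- Isomorphic tree families have isomorphic substitutions. -/
def substituteIso {T T' : G.TreeFamily} (f : ∀ v, DecTree.Iso (T v) (T' v)) :
    Iso (G.substitute T) (G.substitute T') where
  v := Equiv.sigmaCongrRight fun v => (f v).v
  e := Equiv.sumCongr (Equiv.refl _) (Equiv.sigmaCongrRight fun v => (f v).e)
  src := by
    rintro (e | ⟨v, e⟩)
    · exact congrArg (Sigma.mk (G.src e)) ((f _).outLeg _)
    · exact congrArg (Sigma.mk v) ((f v).src e)
  tgt := by
    rintro (e | ⟨v, e⟩)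
    · exact congrArg (Sigma.mk (G.tgt e)) ((f _).inLeg _)
    · exact congrArg (Sigma.mk v) ((f v).tgt e)
  pt := congrArg (Sigma.mk G.pt) ((f _).pt rfl).symm

/-- An isomorphism of substitutions over `G` is induced by isomorphisms of trees. -/
theorem exists_iso_of_substitute {T T' : G.TreeFamily}
    (j : Iso (G.substitute T) (G.substitute T')) (hv : ∀ a, (j.v a).1 = a.1)
    (he : ∀ e : G.E, j.e (Sum.inl e) = Sum.inl e) :
    ∃ f : ∀ v, DecTree.Iso (T v) (T' v), (∀ v a, j.v ⟨v, a⟩ = ⟨v, (f v).v a⟩) ∧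
      ∀ v x, j.e (Sum.inr ⟨v, x⟩) = Sum.inr ⟨v, (f v).e x⟩ := by
  have h1 : ∀ v a, ∃ b, j.v ⟨v, a⟩ = ⟨v, b⟩ := fun v a => by
    have := hv ⟨v, a⟩
    rcases hj : j.v ⟨v, a⟩ with ⟨w, b⟩
    rw [hj] at this
    cases this
    exact ⟨b, rfl⟩
  have h2 : ∀ v x, ∃ y, j.e (Sum.inr ⟨v, x⟩) = Sum.inr ⟨v, y⟩ := fun v x => by
    have h3 := (congrArg Sigma.fst (j.src (Sum.inr ⟨v, x⟩))).trans (hv _)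
    rcases hj : j.e (Sum.inr ⟨v, x⟩) with e | ⟨w, y⟩
    · rw [← he e] at hj
      cases j.e.injective hj
    · rw [hj] at h3
      cases h3
      exact ⟨y, rfl⟩
  choose fv hfv using h1
  choose fe hfe using h2
  have hmk : ∀ (v : G.V) (a b : (T' v).V), (⟨v, a⟩ : (G.substitute T').V) = ⟨v, b⟩ → a = b :=
    fun v a b h => eq_of_heq (Sigma.mk.inj_iff.1 h).2
  have bv : ∀ v, Function.Bijective (fv v) := fun v => by
    constructor
    · intro a b hab
      have : j.v ⟨v, a⟩ = j.v ⟨v, b⟩ := by rw [hfv, hfv, hab]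
      exact eq_of_heq (Sigma.mk.inj_iff.1 (j.v.injective this)).2
    · intro b
      obtain ⟨⟨w, a⟩, ha⟩ := j.v.surjective ⟨v, b⟩
      have h3 := hv ⟨w, a⟩
      rw [ha] at h3
      cases h3
      rw [hfv] at ha
      exact ⟨a, hmk _ _ _ ha⟩
  have be : ∀ v, Function.Bijective (fe v) := fun v => by
    constructor
    · intro a b hab
      have : j.e (Sum.inr ⟨v, a⟩) = j.e (Sum.inr ⟨v, b⟩) := by rw [hfe, hfe, hab]
      exact eq_of_heq (Sigma.mk.inj_iff.1 (Sum.inr_injective (j.e.injective this))).2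
    · intro b
      obtain ⟨e | ⟨w, a⟩, ha⟩ := j.e.surjective (Sum.inr ⟨v, b⟩)
      · rw [he] at ha
        cases ha
      · rw [hfe] at ha
        cases ha
        exact ⟨a, rfl⟩
  refine ⟨fun v => ⟨Equiv.ofBijective _ (bv v), Equiv.ofBijective _ (be v), fun x => ?_,
    fun x => ?_, fun l => ?_, fun l => ?_, fun h => ?_⟩, hfv, hfe⟩
  · have := j.src (Sum.inr ⟨v, x⟩)
    rw [hfe] at this
    exact hmk _ _ _ (this.trans (hfv v _))
  · have := j.tgt (Sum.inr ⟨v, x⟩)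
    rw [hfe] at this
    exact hmk _ _ _ (this.trans (hfv v _))
  · obtain ⟨e, rfl⟩ := l
    have := j.src (Sum.inl e)
    rw [he] at this
    exact hmk _ _ _ (this.trans (hfv _ _))
  · obtain ⟨e, rfl⟩ := l
    have := j.tgt (Sum.inl e)
    rw [he] at this
    exact hmk _ _ _ (this.trans (hfv _ _))
  · subst h
    exact hmk _ _ _ (j.pt.symm.trans (hfv _ _))

end TreeFamily

/-! ### The fibres of a collapse as decorated trees. -/

namespace Collapse

variable {Z G : PGraph} (μ : Collapse Z G)

theorem v_src_eq {x : Z.E} (hx : Z.Contractible x) : μ.v (Z.src x) = μ.v (Z.tgt x) :=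
  (μ.eq_iff _ _).2 (.rel _ _ ⟨x, hx, rfl, rfl⟩)

/-- The vertices of `Z` over a vertex of `G`. -/
abbrev FiberV (v : G.V) : Type := {a : Z.V // μ.v a = v}

/-- The contracted edges of `Z` over a vertex of `G`. -/
abbrev FiberE (v : G.V) : Type := {x : Z.E // Z.Contractible x ∧ μ.v (Z.src x) = v}

/-- The source map of the fibre over a vertex. -/
def fiberSrc (v : G.V) (x : μ.FiberE v) : μ.FiberV v := ⟨Z.src x.1, x.2.2⟩

/-- The target map of the fibre over a vertex. -/
def fiberTgt (v : G.V) (x : μ.FiberE v) : μ.FiberV v :=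
  ⟨Z.tgt x.1, (μ.v_src_eq x.2.1).symm.trans x.2.2⟩

theorem fiber_connected (v : G.V) (a b : μ.FiberV v) : Relation.EqvGen
    (fun a b => ∃ e, μ.fiberSrc v e = a ∧ μ.fiberTgt v e = b) a b := by
  obtain ⟨a, ha⟩ := a
  obtain ⟨b, hb⟩ := b
  have h := (μ.eq_iff a b).1 (ha.trans hb.symm)
  induction h with
  | rel x y h =>
    obtain ⟨e, he, rfl, rfl⟩ := h
    exact .rel _ _ ⟨⟨e, he, ha⟩, rfl, rfl⟩
  | refl => exact .refl _
  | symm _ _ _ ih => exact .symm _ _ (ih _ _)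
  | trans x y z h₁ _ ih₁ ih₂ =>
    have hy : μ.v y = v := ((μ.eq_iff _ _).2 h₁).symm.trans ha
    exact .trans _ _ _ (ih₁ ha hy) (ih₂ hy hb)

/-- Connectedness gives `≤` in every fibre. Summed over the fibres this is an equality by `card_V`,
so it is an equality in each of them. -/
theorem card_fiber (hw : Z.weight = G.weight) (v : G.V) :
    Nat.card (μ.FiberV v) = Nat.card (μ.FiberE v) + 1 := by
  have := Fintype.ofFinite G.V
  have hle : ∀ v ∈ Finset.univ, Nat.card (μ.FiberV v) ≤ Nat.card (μ.FiberE v) + 1 := fun v _ => by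
    simpa using card_le_card_add_card_of_connected (μ.fiberSrc v) (μ.fiberTgt v) (fun _ => ())
      fun a b _ => μ.fiber_connected v a b
  have h1 : ∑ v, Nat.card (μ.FiberV v) = Nat.card Z.V := sum_card_fibers μ.v
  have h2 : ∑ v, Nat.card (μ.FiberE v) = Nat.card {x // Z.Contractible x} := by
    rw [← sum_card_fibers fun x : {x // Z.Contractible x} => μ.v (Z.src x.1)]
    exact Finset.sum_congr rfl fun v _ =>
      Nat.card_congr (Equiv.subtypeSubtypeEquivSubtypeInter _ _).symm
  have h3 := μ.card_V hw
  refine (Finset.sum_eq_sum_iff_of_le hle).1 ?_ v (Finset.mem_univ v)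
  rw [Finset.sum_add_distrib, h1, h2, h3]
  simp [add_comm]

/-- The trees contracted by a collapse. -/
def fiberTree (hw : Z.weight = G.weight) : G.TreeFamily := fun v =>
  { V := μ.FiberV v
    E := μ.FiberE v
    src := μ.fiberSrc v
    tgt := μ.fiberTgt v
    outLeg := fun l => ⟨Z.src (μ.e l.1), (μ.src l.1).symm.trans l.2⟩
    inLeg := fun l => ⟨Z.tgt (μ.e l.1), (μ.tgt l.1).symm.trans l.2⟩
    pt := fun h => ⟨Z.pt, μ.pt.symm.trans h.symm⟩
    connected := μ.fiber_connected v
    card_eq := μ.card_fiber hw v }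

/-- A graph is recovered by substituting the trees contracted by a collapse. -/
noncomputable def fiberTreeIso (hw : Z.weight = G.weight) :
    Iso (G.substitute (μ.fiberTree hw)) Z where
  v := Equiv.sigmaFiberEquiv μ.v
  e := Equiv.ofBijective (Sum.elim μ.e fun x : Σ v, μ.FiberE v => x.2.1) (by
    constructor
    · rintro (a | ⟨v, a, ha, rfl⟩) (b | ⟨w, b, hb, rfl⟩) h
      · exact congrArg Sum.inl (μ.inj h)
      · exact absurd hb ((μ.range_iff _).1 ⟨a, h⟩)
      · exact absurd ha ((μ.range_iff _).1 ⟨b, h.symm⟩)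
      · cases h
        rfl
    · intro x
      by_cases hx : Z.Contractible x
      · exact ⟨Sum.inr ⟨_, x, hx, rfl⟩, rfl⟩
      · obtain ⟨y, hy⟩ := (μ.range_iff x).2 hx
        exact ⟨Sum.inl y, hy⟩)
  src := by rintro (e | ⟨v, e⟩) <;> rfl
  tgt := by rintro (e | ⟨v, e⟩) <;> rfl
  pt := rfl

end Collapse

end PGraph

/-! ### The simply transitive action of automorphisms on collapses. -/

namespace PGraph

namespace Iso

variable {G H K : PGraph}

theorem ext {f g : Iso G H} (hv : ∀ a, f.v a = g.v a) (he : ∀ x, f.e x = g.e x) : f = g := by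
  obtain ⟨fv, fe, _, _, _⟩ := f
  obtain ⟨gv, ge, _, _, _⟩ := g
  obtain rfl : fv = gv := Equiv.ext hv
  obtain rfl : fe = ge := Equiv.ext he
  rfl

instance : Finite (Iso G H) :=
  Finite.of_injective (fun f : Iso G H => (f.v, f.e)) fun _ _ h =>
    ext (fun a => DFunLike.congr_fun (congrArg Prod.fst h) a)
      fun x => DFunLike.congr_fun (congrArg Prod.snd h) x

instance : Nonempty (Iso G G) := isoSetoid.refl G

/-- The inverse isomorphism. -/
def symm (f : Iso G H) : Iso H G where
  v := f.v.symm
  e := f.e.symm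
  src x := by rw [Equiv.eq_symm_apply, ← f.src, Equiv.apply_symm_apply]
  tgt x := by rw [Equiv.eq_symm_apply, ← f.tgt, Equiv.apply_symm_apply]
  pt := by rw [Equiv.symm_apply_eq, f.pt]

/-- The composition of isomorphisms. -/
def trans (f : Iso G H) (g : Iso H K) : Iso G K where
  v := f.v.trans g.v
  e := f.e.trans g.e
  src x := by rw [Equiv.trans_apply, Equiv.trans_apply, g.src, f.src]
  tgt x := by rw [Equiv.trans_apply, Equiv.trans_apply, g.tgt, f.tgt]
  pt := by rw [Equiv.trans_apply, f.pt, g.pt]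

theorem eqvGen (f : Iso G H) {a b : G.V} (h : Relation.EqvGen G.ContrAdj a b) :
    Relation.EqvGen H.ContrAdj (f.v a) (f.v b) := by
  induction h with
  | rel x y h =>
    obtain ⟨e, he, rfl, rfl⟩ := h
    exact .rel _ _ ⟨f.e e, (f.contractible e).2 he, f.src e, f.tgt e⟩
  | refl => exact .refl _
  | symm _ _ _ ih => exact .symm _ _ ih
  | trans _ _ _ _ _ ih₁ ih₂ => exact .trans _ _ _ ih₁ ih₂

theorem card_eq_autCard (f : Iso G H) : Nat.card (Iso G H) = H.autCard :=
  Nat.card_congr ⟨fun g => f.symm.trans g, fun g => f.trans g,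
    fun g => ext (fun a => congrArg g.v (f.v.symm_apply_apply a))
      fun x => congrArg g.e (f.e.symm_apply_apply x),
    fun g => ext (fun a => congrArg g.v (f.v.apply_symm_apply a))
      fun x => congrArg g.e (f.e.apply_symm_apply x)⟩

end Iso

theorem autCard_pos (G : PGraph) : 0 < G.autCard := Nat.card_pos

namespace Collapse

variable {Z Z' G : PGraph}

/-- Transport of a collapse along an isomorphism. -/
def map (μ : Collapse Z G) (f : Iso Z Z') : Collapse Z' G where
  v := μ.v ∘ f.v.symm
  e := f.e ∘ μ.e
  surj := μ.surj.comp f.v.symm.surjective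
  eq_iff a b := by
    refine (μ.eq_iff _ _).trans ⟨fun h => ?_, f.symm.eqvGen⟩
    have := f.eqvGen h
    rwa [f.v.apply_symm_apply, f.v.apply_symm_apply] at this
  inj := f.e.injective.comp μ.inj
  range_iff x := by
    rw [← f.e.apply_symm_apply x, f.contractible, ← μ.range_iff]
    exact exists_congr fun y => f.e.apply_eq_iff_eq
  src y := by rw [Function.comp, Function.comp, f.src, f.v.symm_apply_apply, μ.src]
  tgt y := by rw [Function.comp, Function.comp, f.tgt, f.v.symm_apply_apply, μ.tgt]
  pt := by rw [Function.comp, ← f.pt, f.v.symm_apply_apply, μ.pt]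

/-- The composition of a collapse with an automorphism of its target. -/
def compAut (μ : Collapse Z G) (f : Iso G G) : Collapse Z G where
  v := f.v ∘ μ.v
  e := μ.e ∘ f.e.symm
  surj := f.v.surjective.comp μ.surj
  eq_iff a b := f.v.apply_eq_iff_eq.trans (μ.eq_iff a b)
  inj := μ.inj.comp f.e.symm.injective
  range_iff x := by
    rw [← μ.range_iff]
    exact ⟨fun ⟨y, hy⟩ => ⟨_, hy⟩, fun ⟨y, hy⟩ => ⟨f.e y, by
      rw [Function.comp, f.e.symm_apply_apply, hy]⟩⟩
  src y := by rw [Function.comp, Function.comp, ← μ.src, ← f.src, f.e.apply_symm_apply]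
  tgt y := by rw [Function.comp, Function.comp, ← μ.tgt, ← f.tgt, f.e.apply_symm_apply]
  pt := by rw [Function.comp, ← μ.pt, f.pt]

/-- Two collapses of `Z` have the same fibres and the same surviving edges, both determined by the
contractible edges of `Z`. They therefore differ by an automorphism of `G`, unique as `μ.v` is
surjective and `μ.e` injective. -/
theorem bijective_compAut (μ : Collapse Z G) : Function.Bijective μ.compAut := by
  constructor
  · intro f g h
    refine Iso.ext (fun w => ?_) fun x => ?_
    · obtain ⟨a, rfl⟩ := μ.surj w
      exact congrFun (congrArg Collapse.v h) a
    · have h1 := μ.inj (congrFun (congrArg Collapse.e h) (g.e x))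
      rw [g.e.symm_apply_apply, f.e.symm_apply_eq] at h1
      exact h1.symm
  · intro ν
    have hv : ∀ a b, μ.v a = μ.v b ↔ ν.v a = ν.v b := fun a b =>
      (μ.eq_iff a b).trans (ν.eq_iff a b).symm
    choose s hs using μ.surj
    have hf : ∀ a, ν.v (s (μ.v a)) = ν.v a := fun a => (hv _ _).1 (hs _)
    have bf : Function.Bijective fun w => ν.v (s w) := by
      constructor
      · intro w w' h
        have := (hv _ _).2 h
        rwa [hs, hs] at this
      · intro w
        obtain ⟨a, rfl⟩ := ν.surj w
        exact ⟨μ.v a, hf a⟩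
    choose g hg using fun y => (μ.range_iff (ν.e y)).2 ((ν.range_iff _).1 ⟨y, rfl⟩)
    have bg : Function.Bijective g := by
      constructor
      · intro y y' h
        apply ν.inj
        rw [← hg, ← hg, h]
      · intro y
        obtain ⟨y', hy'⟩ := (ν.range_iff (μ.e y)).2 ((μ.range_iff _).1 ⟨y, rfl⟩)
        exact ⟨y', μ.inj (by rw [hg, hy'])⟩
    refine ⟨⟨Equiv.ofBijective _ bf, (Equiv.ofBijective _ bg).symm, fun x => ?_, fun x => ?_, ?_⟩,
      Collapse.ext (funext hf) (funext hg)⟩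
    · obtain ⟨y, rfl⟩ := bg.2 x
      rw [show (Equiv.ofBijective g bg).symm (g y) = y from
        (Equiv.ofBijective g bg).symm_apply_apply y, ν.src y, μ.src (g y), hg]
      exact (hf _).symm
    · obtain ⟨y, rfl⟩ := bg.2 x
      rw [show (Equiv.ofBijective g bg).symm (g y) = y from
        (Equiv.ofBijective g bg).symm_apply_apply y, ν.tgt y, μ.tgt (g y), hg]
      exact (hf _).symm
    · have := hf Z.pt
      rwa [← μ.pt, ← ν.pt] at this

theorem card_eq_autCard (μ : Collapse Z G) : Nat.card (Collapse Z G) = G.autCard :=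
  (Nat.card_congr (Equiv.ofBijective _ μ.bijective_compAut)).symm

end Collapse

/-! ### Counting the terms of the expansion. -/

namespace Expansion

variable {G : PGraph}

instance : Finite G.Expansion :=
  inferInstanceAs (Finite (∀ v : G.V, TreeClass (v = G.pt) {e : G.E // G.src e = v}
    {e : G.E // G.tgt e = v}))

/-- The trees of a term of the expansion. -/
noncomputable def trees (x : G.Expansion) : G.TreeFamily := fun v => (x v).tree

/-- The graph of a term of the expansion. -/
noncomputable def graph (x : G.Expansion) : PGraph := G.substitute x.trees

theorem semistable_graph (x : G.Expansion) : x.graph.Semistable :=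
  x.trees.semistable_substitute_iff.2 fun v => (x v).semistable_tree

theorem weight_graph (x : G.Expansion) : x.graph.weight = G.weight := x.trees.weight_substitute

/-- The collapse of the graph of a term of the expansion of a stable graph. -/
noncomputable def collapse (x : G.Expansion) (hG : G.Stable) : Collapse x.graph G :=
  x.trees.collapse hG (fun v => (x v).semistable_tree) fun v => (x v).contractible_tree

theorem hasStabilization_graph (x : G.Expansion) (hG : G.Stable) : x.graph.HasStabilization G :=
  (Collapse.nonempty_iff x.semistable_graph hG x.weight_graph).1 ⟨x.collapse hG⟩

/-- The collapse induced by an isomorphism of `Z` with the graph of a term of the expansion. -/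
noncomputable def toCollapse (hG : G.Stable) (Z : PGraph)
    (p : Σ x : G.Expansion, Iso x.graph Z) : Collapse Z G :=
  (p.1.collapse hG).map p.2

/-- If two pairs give the same collapse, the composite of one isomorphism with the inverse of the
other lies over `G`, so it comes from isomorphisms of trees. The tree classes then agree, and
rigidity of semistable trees makes the composite the identity. -/
theorem toCollapse_injective (hG : G.Stable) (Z : PGraph) :
    Function.Injective (toCollapse hG Z) := by
  rintro ⟨x, i⟩ ⟨y, j⟩ h
  have hv : ∀ a, ((i.trans j.symm).v a).1 = a.1 := fun a => by
    have := congrFun (congrArg Collapse.v h) (i.v a)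
    exact this.symm.trans (congrArg Sigma.fst (i.v.symm_apply_apply a))
  have he : ∀ e, (i.trans j.symm).e (Sum.inl e) = Sum.inl e := fun e => by
    have := congrFun (congrArg Collapse.e h) e
    exact j.e.symm_apply_eq.2 this
  obtain rfl : x = y := by
    obtain ⟨f, -⟩ := TreeFamily.exists_iso_of_substitute _ hv he
    exact funext fun v => TreeClass.eq_of_iso (f v)
  obtain ⟨f, h1, h2⟩ := TreeFamily.exists_iso_of_substitute _ hv he
  have hf := fun v => (x v).semistable_tree.iso_self_eq (f v)
  refine congrArg (Sigma.mk x) (Iso.ext ?_ ?_)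
  · rintro ⟨v, a⟩
    exact j.v.symm_apply_eq.1 ((h1 v a).trans (congrArg (Sigma.mk v) ((hf v).1 a)))
  · rintro (e | ⟨v, e⟩)
    · exact j.e.symm_apply_eq.1 (he e)
    · exact j.e.symm_apply_eq.1 ((h2 v e).trans
        (congrArg (fun e => Sum.inr (Sigma.mk v e)) ((hf v).2 e)))

/-- The fibre trees of a collapse, substituted into `G`, give back `Z`; replacing each by the chosen
representative of its class changes the graph only by an isomorphism over `G`. -/
theorem toCollapse_surjective (hG : G.Stable) {Z : PGraph} (hZ : Z.Semistable)
    (hw : Z.weight = G.weight) : Function.Surjective (toCollapse hG Z) := by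
  intro μ
  let T := μ.fiberTree hw
  let i := μ.fiberTreeIso hw
  have hs : ∀ v, (T v).Semistable := T.semistable_substitute_iff.1 (i.symm.semistable hZ)
  have hc : ∀ v, (T v).Contractible := fun v x =>
    (T.contractible_inr_iff v x).1 ((i.contractible _).1 x.2.1)
  choose x hx using fun v => TreeClass.exists_iso_tree (hs v) (hc v)
  let f : ∀ v, DecTree.Iso (x v).tree (T v) := fun v => (hx v).some
  let j : Iso (graph x) Z := (TreeFamily.substituteIso f).trans i
  refine ⟨⟨x, j⟩, Collapse.ext (funext fun a => ?_) rfl⟩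
  obtain ⟨⟨v, b⟩, rfl⟩ := j.v.surjective a
  have h1 : (toCollapse hG Z ⟨x, j⟩).v (j.v ⟨v, b⟩) = v :=
    congrArg Sigma.fst (j.v.symm_apply_apply _)
  exact h1.trans ((f v).v b).2.symm

open Classical in
/-- The number of terms of the expansion with graph isomorphic to `Z`. -/
theorem card_mul_autCard (hG : G.Stable) {Z : PGraph} (hZ : Z.Semistable)
    (hw : Z.weight = G.weight) (μ : Collapse Z G) [Fintype G.Expansion] :
    (Finset.univ.filter fun x : G.Expansion => Nonempty (Iso x.graph Z)).card * Z.autCard =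
      G.autCard := by
  -- Pairs are counted by their first component: a term `x` contributes `|Aut Z|` isomorphisms if
  -- its graph is isomorphic to `Z`, and none otherwise.
  rw [← μ.card_eq_autCard, ← Nat.card_congr (Equiv.ofBijective (toCollapse hG Z)
    ⟨toCollapse_injective hG Z, toCollapse_surjective hG hZ hw⟩), Nat.card_sigma,
    Finset.card_filter, Finset.sum_mul]
  refine Finset.sum_congr rfl fun x _ => ?_
  split_ifs with h
  · rw [h.some.card_eq_autCard, one_mul]
  · rw [not_nonempty_iff] at h
    rw [Nat.card_of_isEmpty, zero_mul]

theorem prod_sign (x : G.Expansion) :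
    ∏ᶠ v, (x v).sign = (-1) ^ ((Nat.card x.graph.V : ℤ) - (Nat.card G.V : ℤ)) := by
  have := Fintype.ofFinite G.V
  have h1 : Nat.card x.graph.V = ∑ v, Nat.card (x v).tree.V := Nat.card_sigma
  have h2 : ∑ v, (Nat.card (x v).tree.V + 1) = Nat.card x.graph.V + Nat.card G.V := by
    simp [Finset.sum_add_distrib, h1]
  rw [finprod_eq_prod_of_fintype]
  simp only [TreeClass.sign]
  rw [Finset.prod_pow_eq_pow_sum, h2, ← zpow_natCast]
  -- The sum and the difference of the two vertex numbers have the same parity.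
  have h3 : ((Nat.card x.graph.V + Nat.card G.V : ℕ) : ℤ) =
      ((Nat.card x.graph.V : ℤ) - Nat.card G.V) + 2 * Nat.card G.V := by
    push_cast
    ring
  rw [h3, zpow_add₀ (by norm_num), zpow_mul]
  norm_num

end Expansion

end PGraph

/-! ### The theorem. -/

theorem theorem4p6 (k : ℤ) (Γ : PGraph) (hΓ : Γ.Stable) (hk : Γ.weight = k) :
    Finite Γ.Expansion ∧
    ∃ hfin : (PGraph.stabilizingClasses k Γ).Finite,
      Γ.D = ∑ z ∈ hfin.toFinset, Finsupp.single z (Γ.coeff (Quotient.out z)) := by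
  classical
  have := Fintype.ofFinite Γ.Expansion
  have hmem : ∀ z ∈ PGraph.stabilizingClasses k Γ, (Quotient.out z).Semistable ∧
      (Quotient.out z).weight = Γ.weight ∧ Nonempty (PGraph.Collapse (Quotient.out z) Γ) := by
    rintro z ⟨Z, rfl, hZk, hZ⟩
    obtain ⟨f⟩ : Nonempty (PGraph.Iso Z (Quotient.out (⟦Z⟧ : PGraph.Class))) :=
      Setoid.symm (Quotient.mk_out Z)
    obtain ⟨μ⟩ := (PGraph.Collapse.nonempty_iff hZ.1 hΓ (hZk.trans hk.symm)).2 hZ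
    exact ⟨f.semistable hZ.1, by rw [f.weight, hZk, hk], ⟨μ.map f⟩⟩
  have hgraph : ∀ x : Γ.Expansion, (⟦x.graph⟧ : PGraph.Class) ∈ PGraph.stabilizingClasses k Γ :=
    fun x => ⟨x.graph, rfl, by rw [x.weight_graph, hk], x.hasStabilization_graph hΓ⟩
  have hiso : ∀ (x : Γ.Expansion) (z : PGraph.Class),
      (⟦x.graph⟧ : PGraph.Class) = z ↔ Nonempty (PGraph.Iso x.graph (Quotient.out z)) :=
    fun x z => by
      conv_lhs => rw [← Quotient.out_eq z]
      exact Quotient.eq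
  have hcount : ∀ z ∈ PGraph.stabilizingClasses k Γ,
      (Finset.univ.filter fun x : Γ.Expansion => (⟦x.graph⟧ : PGraph.Class) = z).card *
        (Quotient.out z).autCard = Γ.autCard := fun z hz => by
    obtain ⟨h1, h2, ⟨μ⟩⟩ := hmem z hz
    simp only [hiso]
    convert PGraph.Expansion.card_mul_autCard hΓ h1 h2 μ
  have hfin : (PGraph.stabilizingClasses k Γ).Finite := by
    refine (Set.finite_range fun x : Γ.Expansion => (⟦x.graph⟧ : PGraph.Class)).subset fun z hz => ?_
    -- The count times `|Aut Z|` is `|Aut Γ| > 0`, so every class is the class of one of the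
    -- finitely many terms.
    have hpos : 0 < (Finset.univ.filter fun x : Γ.Expansion =>
        (⟦x.graph⟧ : PGraph.Class) = z).card :=
      Nat.pos_of_mul_pos_right ((hcount z hz).symm ▸ Γ.autCard_pos)
    obtain ⟨x, hx⟩ := Finset.card_pos.1 hpos
    exact ⟨x, (Finset.mem_filter.1 hx).2⟩
  refine ⟨inferInstance, hfin, ?_⟩
  have hD : Γ.D = ∑ x : Γ.Expansion, Finsupp.single (⟦x.graph⟧ : PGraph.Class)
      ((-1 : ℚ) ^ ((Nat.card x.graph.V : ℤ) - (Nat.card Γ.V : ℤ))) := by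
    rw [PGraph.D, finsum_eq_sum_of_fintype]
    exact Finset.sum_congr rfl fun x _ => by rw [x.prod_sign]; rfl
  -- The terms are grouped by isomorphism class; within a class they are all equal, and `hcount`
  -- gives their number.
  rw [hD, ← Finset.sum_fiberwise_of_maps_to (g := fun x : Γ.Expansion =>
    (⟦x.graph⟧ : PGraph.Class)) fun x _ => hfin.mem_toFinset.2 (hgraph x)]
  refine Finset.sum_congr rfl fun z hz => ?_
  have hc := hcount z (hfin.mem_toFinset.1 hz)
  have hterm : ∀ x ∈ Finset.univ.filter fun x : Γ.Expansion => (⟦x.graph⟧ : PGraph.Class) = z,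
      Finsupp.single (⟦x.graph⟧ : PGraph.Class)
        ((-1 : ℚ) ^ ((Nat.card x.graph.V : ℤ) - (Nat.card Γ.V : ℤ))) =
      Finsupp.single z ((-1 : ℚ) ^ ((Nat.card (Quotient.out z).V : ℤ) - (Nat.card Γ.V : ℤ))) := by
    intro x hx
    have hx' := (Finset.mem_filter.1 hx).2
    obtain ⟨f⟩ := (hiso x z).1 hx'
    rw [hx', Nat.card_congr f.v]
  rw [Finset.sum_congr rfl hterm, Finset.sum_const, Finsupp.smul_single, nsmul_eq_mul, PGraph.coeff,
    ← hc]
  have hpos : ((Quotient.out z).autCard : ℚ) ≠ 0 :=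
    Nat.cast_ne_zero.2 (Quotient.out z).autCard_pos.ne'
  congr 1
  push_cast
  field_simp
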